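/- Let $\Omega\subset\mathbb R^d$, $d\ge 1$, be a bounded domain, $U=H_0^1(\Omega)$ with a Hilbert inner product $(\cdot,\cdot)$ inducing the usual topology of $H_0^1(\Omega)$, and norm $\|\cdot\|$; the dual is identified with $U$ when gradients are formed. Let $p\in(0,1)$, $\alpha>0$, $\beta>0$, and let $f:U\to\mathbb R$ be Fréchet differentiable with Lipschitz continuous gradient, such that $f+\phi$ is bounded below, where $\phi(u)=\beta\int_\Omega|u|^p\,dx+\frac\alpha2\|u\|^2$. For $\epsilon>0$ put $\psi_\epsilon(t)=\frac p2\frac t{\epsilon^{2-p}}+(1-\frac p2)\epsilon^p$ for $0\le t<\epsilon^2$ and $\psi_\epsilon(t)=t^{p/2}$ for $t\ge\epsilon^2$. Given $u_k\in U$ and $\epsilon_k>0$, put $$\phi_{\epsilon_k}(u)=\beta\int_\Omega\psi_{\epsilon_k}(u^2)\,dx+\tfrac\alpha2\|u\|^2,\qquad \phi_k(u)=\beta\int_\Omega\psi_{\epsilon_k}(u_k^2)+\psi_{\epsilon_k}'(u_k^2)(u^2-u_k^2)\,dx+\tfrac\alpha2\|u\|^2,$$ and, for $r_0>0$, $p_k=\operatorname{prox}_{r_0\phi_k}(u_k-r_0\nabla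 f(u_k))$ and $h_k(u_k)=\frac1{r_0}\|p_k-u_k\|$, where $\operatorname{prox}_{r\Phi}(u)=\arg\min_v\frac1{2r}\|v-u\|^2+\Phi(v)$. **The algorithm.** Let $\epsilon_k>0$ decrease monotonically to $0$, and let $0<\eta_1<\eta_2<1$, $0<\gamma_1\le\gamma_2<1\le\gamma_3$, $\kappa_{\rm fcd},\kappa_{\rm rad}>0$, $\Delta_0>0$, $u_0\in U$. In iteration $k$ a model $m_k=f_k+\Phi_k$ with $\Phi_k\in\{\phi_k,\phi_{\epsilon_k}\}$ is chosen. Let $\omega(f_k,u_k,s)=\frac2{\|s\|^2}\left(f_k(u_k+s)-f_k(u_k)-(\nabla f_k(u_k),s)\right)$, $\omega_k=\sup\{|\omega(f_k,u_k,s)|:0<\|s\|\le\kappa_{\rm rad}\Delta_k\}$ and $h_k=\frac1{r_0}\|\operatorname{prox}_{r_0\phi_k}(u_k-r_0\nabla f_k(u_k))-u_k\|$. A trial point $t_k$ with $\|t_k-u_k\|\le\kappa_{\rm rad}\Delta_k$ is computed with $$\mathrm{pred}_k:=m_k(u_k)-m_k(t_k)\ge\kappa_{\rm fcd}\,h_k\min\left(\tfrac{h_k}{1+\omega_k},\Delta_k\right).$$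 With a computed reduction $\mathrm{cred}_k$ put $\rho_k=\mathrm{cred}_k/\mathrm{pred}_k$. If $\rho_k<\eta_1$, then $u_{k+1}=u_k$ and $\Delta_{k+1}\in[\gamma_1\Delta_k,\gamma_2\Delta_k]$; otherwise (a successful iteration) $u_{k+1}=t_k$, with $\Delta_{k+1}\in[\gamma_2\Delta_k,\Delta_k]$ if $\rho_k<\eta_2$ and $\Delta_{k+1}\in[\Delta_k,\gamma_3\Delta_k]$ if $\rho_k\ge\eta_2$. It is assumed that * each $f_k$ is differentiable with Lipschitz gradient (with a constant $L_k$), and $\|\nabla f_k(u_k)-\nabla f(u_k)\|\le\kappa_{\rm grad}\min(h_k,\Delta_k)$ for all $k$, with $\kappa_{\rm grad}\ge 0$ independent of $k$; * for $\mathrm{ared}_k=f(u_k)+\Phi_k(u_k)-f(t_k)-\Phi_k(t_k)$ one has $|\mathrm{ared}_k-\mathrm{cred}_k|\le\kappa_{\rm obj}\,(\eta\min(\mathrm{pred}_k,\theta_k))^{\zeta}$ for all $k$, for some $\kappa_{\rm obj}\ge0$, $\zeta>1$, $0<\eta<\min(\eta_1,1-\eta_2)$ and $0\le\theta_k\to0$;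 * $\sum_{k\ge1}1/b_k=\infty$ for $b_k=1+\max\{\omega_1,\dots,\omega_k\}$. **Claims.** 1. Let $(u_k)\subset U$ be any sequence and let $\epsilon_k>0$ decrease monotonically to $0$. If $u_k\rightharpoonup\bar u$ and $p_k-u_k\to0$ in $U$, then $2\int_\Omega\psi_{\epsilon_k}'(u_k^2)\,p_k^2\,dx\to p\int_\Omega|\bar u|^p\,dx$. 2. Let $(u_k)$ be generated by the algorithm under the assumptions above, with only finitely many successful iterations. Then there is $\bar u\in U$ with $u_k=\bar u$ for all large $k$, and there is $\bar\lambda\in U^*$ with $$\alpha(\bar u,v)+\beta\langle\bar\lambda,v\rangle=-f'(\bar u)v\quad\text{for all }v\in U,\qquad\langle\bar\lambda,\bar u\rangle=p\int_\Omega|\bar u|^p\,dx .$$ 3. Let $\nabla f$ be completely continuous (it maps weakly convergent sequences to strongly convergent ones, with the corresponding limit). Let $(u_k)\subset U$ be any sequence (for instance one generated by the algorithm) and let $\epsilon_k>0$ decrease monotonically to $0$. If $h_k(u_k)\to0$ along a subsequence, and $\bar u$ is the weak limit of a further subsequence of it, then there is $\bar\lambda\in U^*$ with $$\alpha(\bar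 u,v)+\beta\langle\bar\lambda,v\rangle=-f'(\bar u)v\quad\text{for all }v\in U,\qquad\langle\bar\lambda,\bar u\rangle\ge p\int_\Omega|\bar u|^p\,dx .$$ -/

import Mathlib

open Filter Topology MeasureTheory
open scoped ContDiff Gradient NNReal RealInnerProductSpace

noncomputable section

namespace SmoothedTR

/-- `ℝ^d` with the Euclidean norm. -/
abbrev Dom (d : ℕ) : Type := EuclideanSpace ℝ (Fin d)

/-! ### The space `H_0^1(Ω)` -/

/-- The ambient Hilbert space `L²(Ω) × L²(Ω; ℝ^d)` of pairs (function, gradient), with inner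
product `⟪(u, g), (v, h)⟫ = ∫_Ω u v + ∫_Ω g · h`. -/
abbrev GraphSpace {d : ℕ} (Ω : Set (Dom d)) : Type :=
  WithLp 2 (Lp ℝ 2 (volume.restrict Ω) × Lp (Dom d) 2 (volume.restrict Ω))

/-- `φ ∈ C_c^∞(Ω)`. -/
def IsTestFunction {d : ℕ} (Ω : Set (Dom d)) (φ : Dom d → ℝ) : Prop :=
  ContDiff ℝ ∞ φ ∧ HasCompactSupport φ ∧ tsupport φ ⊆ Ω

/-- The subspace `{(φ, ∇φ) : φ ∈ C_c^∞(Ω)}` of `L²(Ω) × L²(Ω; ℝ^d)`. -/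
def testGraph {d : ℕ} (Ω : Set (Dom d)) : Submodule ℝ (GraphSpace Ω) where
  carrier := {w | ∃ φ : Dom d → ℝ, IsTestFunction Ω φ ∧
    (w.fst : Dom d → ℝ) =ᵐ[volume.restrict Ω] φ ∧
    (w.snd : Dom d → Dom d) =ᵐ[volume.restrict Ω] ∇ φ}
  zero_mem' := by
    refine ⟨0, ⟨contDiff_const, HasCompactSupport.zero, by simp [tsupport]⟩, ?_, ?_⟩
    · exact Lp.coeFn_zero _ _ _
    · refine (Lp.coeFn_zero _ _ _).trans (Eventually.of_forall fun x => ?_)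
      simp only [gradient]
      rw [show (0 : Dom d → ℝ) = fun _ => 0 from rfl, fderiv_fun_const]
      simp
  add_mem' := by
    rintro a b ⟨φ, ⟨h1, h2, h3⟩, h4, h5⟩ ⟨χ, ⟨k1, k2, k3⟩, k4, k5⟩
    refine ⟨φ + χ, ⟨h1.add k1, h2.add k2, (tsupport_add φ χ).trans (Set.union_subset h3 k3)⟩,
      ?_, ?_⟩
    · exact (Lp.coeFn_add a.fst b.fst).trans (h4.add k4)
    · refine (Lp.coeFn_add a.snd b.snd).trans ?_
      filter_upwards [h5, k5] with x hx kx
      rw [Pi.add_apply, hx, kx]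
      simp only [gradient]
      rw [fderiv_add (h1.differentiable (by simp) x) (k1.differentiable (by simp) x), map_add]
  smul_mem' := by
    rintro c a ⟨φ, ⟨h1, h2, h3⟩, h4, h5⟩
    refine ⟨c • φ, ⟨h1.const_smul c, h2.mono (Function.support_const_smul_subset c φ),
      (closure_mono (Function.support_const_smul_subset c φ)).trans h3⟩, ?_, ?_⟩
    · exact (Lp.coeFn_smul c a.fst).trans (h4.const_smul c)
    · refine (Lp.coeFn_smul c a.snd).trans ?_
      filter_upwards [h5] with x hx
      rw [Pi.smul_apply, hx]
      simp only [gradient]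
      rw [fderiv_const_smul (h1.differentiable (by simp) x)]
      simp

/-- `H_0^1(Ω)`: the closure of `C_c^∞(Ω)` in the `H^1` norm. An element is the pair `(u, ∇u)` of a
function and its weak gradient; the inherited inner product is `∫_Ω u v + ∫_Ω ∇u · ∇v`. -/
abbrev H01 {d : ℕ} (Ω : Set (Dom d)) : Type := (testGraph Ω).topologicalClosure

/-- The function on `Ω` underlying an element of `H_0^1(Ω)`. -/
def H01.fn {d : ℕ} {Ω : Set (Dom d)} (u : H01 Ω) : Dom d → ℝ :=
  ((u : GraphSpace Ω).fst : Lp ℝ 2 (volume.restrict Ω))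

/-! ### The smoothed `L^p` pseudonorm -/

/-- `ψ_ε(t) = (p/2) t / ε^(2-p) + (1 - p/2) ε^p` for `t < ε²`, and `t^(p/2)` for `t ≥ ε²`. It is
only evaluated at `t ≥ 0`; as the affine branch is continued to `t < 0`, the two-sided derivative at
`0` is the one-sided derivative there. -/
def psi (p ε t : ℝ) : ℝ :=
  if t < ε ^ 2 then p / 2 * (t / ε ^ (2 - p)) + (1 - p / 2) * ε ^ p else t ^ (p / 2)

section Functionals

/- `U` is the space `H_0^1(Ω)` with a Hilbert space inner product that is equivalent to the
standard one; `e` is the identity map, regarded as an isomorphism onto `H01 Ω`. -/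
variable {d : ℕ} {Ω : Set (Dom d)} {U : Type*} [NormedAddCommGroup U] [InnerProductSpace ℝ U]
  (e : U ≃L[ℝ] H01 Ω)

/-- `∫_Ω |u|^p`. -/
def lpPseudo (p : ℝ) (u : U) : ℝ := ∫ x in Ω, |(e u).fn x| ^ p

/-- `j_ε(u) = ∫_Ω ψ_ε(u²)`. -/
def jEps (p ε : ℝ) (u : U) : ℝ := ∫ x in Ω, psi p ε ((e u).fn x ^ 2)

/-- The quadratic majorant `∫_Ω ψ_ε(w²) + ψ_ε'(w²) (u² - w²)` of `j_ε` at `w`. -/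
def jMaj (p ε : ℝ) (w u : U) : ℝ :=
  ∫ x in Ω, (psi p ε ((e w).fn x ^ 2) +
    deriv (psi p ε) ((e w).fn x ^ 2) * ((e u).fn x ^ 2 - (e w).fn x ^ 2))

/-- `φ(u) = β ∫_Ω |u|^p + (α/2) ‖u‖²`. -/
def phi (p α β : ℝ) (u : U) : ℝ := β * lpPseudo e p u + α / 2 * ‖u‖ ^ 2

/-- `φ_ε(u) = β j_ε(u) + (α/2) ‖u‖²`. -/
def phiEps (p α β ε : ℝ) (u : U) : ℝ := β * jEps e p ε u + α / 2 * ‖u‖ ^ 2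

/-- `φ_k` for `ε = ε_k` and `w = u_k`: the majorant of `φ_ε` at `w`. -/
def phiMaj (p α β ε : ℝ) (w u : U) : ℝ := β * jMaj e p ε w u + α / 2 * ‖u‖ ^ 2

end Functionals

/-! ### Proximal points, smoothness, curvature, convergence -/

section Hilbert

variable {U : Type*} [NormedAddCommGroup U] [InnerProductSpace ℝ U]

/-- `v` minimizes `‖v - u‖² / (2 r) + Φ(v)`. -/
def IsProx (r : ℝ) (Φ : U → ℝ) (u v : U) : Prop :=
  ∀ w, 1 / (2 * r) * ‖v - u‖ ^ 2 + Φ v ≤ 1 / (2 * r) * ‖w - u‖ ^ 2 + Φ w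

/-- The proximal point `prox_{rΦ}(u)`. It is only used for strongly convex continuous `Φ`, where it
exists and is unique. -/
def prox (r : ℝ) (Φ : U → ℝ) (u : U) : U := Classical.epsilon (IsProx r Φ u)

/-- `(1/r) ‖prox_{rΦ}(u - r g) - u‖`. -/
def proxResidual (r : ℝ) (Φ : U → ℝ) (g u : U) : ℝ := 1 / r * ‖prox r Φ (u - r • g) - u‖

/-- Weak convergence of a sequence. -/
def WeaklyTendsto (u : ℕ → U) (a : U) : Prop :=
  Tendsto (fun k => toWeakSpace ℝ U (u k)) atTop (𝓝 (toWeakSpace ℝ U a))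

/-- A map is completely continuous if it maps weakly convergent sequences to strongly convergent
ones. -/
def IsCompletelyContinuous (G : U → U) : Prop :=
  ∀ (u : ℕ → U) (a : U), WeaklyTendsto u a → Tendsto (fun k => G (u k)) atTop (𝓝 (G a))

variable [CompleteSpace U]

/-- `f` is Fréchet differentiable with `L`-Lipschitz continuous gradient. -/
def IsLSmooth (L : ℝ≥0) (f : U → ℝ) : Prop := Differentiable ℝ f ∧ LipschitzWith L (∇ f)

/-- The curvature `ω(f, u, s) = 2 / ‖s‖² (f(u+s) - f(u) - ⟨∇f(u), s⟩)`. -/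
def curvature (f : U → ℝ) (u s : U) : ℝ :=
  2 / ‖s‖ ^ 2 * (f (u + s) - f u - ⟪∇ f u, s⟫)

end Hilbert

/-! ### The smoothed proximal trust-region algorithm -/

/-- The parameters and the sequences that occur in a run of the algorithm. -/
structure Data (U : Type*) where
  /-- prox parameter in the definition of `h_k` -/
  r₀ : ℝ
  η₁ : ℝ
  η₂ : ℝ
  γ₁ : ℝ
  γ₂ : ℝ
  γ₃ : ℝ
  κfcd : ℝ
  κrad : ℝ
  /-- smoothing parameters `ε_k` -/
  ε : ℕ → ℝ
  /-- iterates `u_k` -/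
  u : ℕ → U
  /-- trial points, i.e. `u_{k+1}` before the acceptance test -/
  trial : ℕ → U
  /-- trust-region radii `Δ_k` -/
  Δ : ℕ → ℝ
  /-- local models `f_k` of `f` -/
  model : ℕ → U → ℝ
  /-- `true` if the nonconvex model `m_k^ε` is used in iteration `k`, `false` for `m_k` -/
  nonconvex : ℕ → Bool
  /-- computed reductions -/
  cred : ℕ → ℝ

namespace Data

variable {d : ℕ} {Ω : Set (Dom d)} {U : Type*} [NormedAddCommGroup U] [InnerProductSpace ℝ U]
  (D : Data U) (e : U ≃L[ℝ] H01 Ω) (p α β : ℝ) (f : U → ℝ)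

/-- The regularizer in the chosen model: `φ_{ε_k}` or `φ_k`. -/
def reg (k : ℕ) (v : U) : ℝ :=
  if D.nonconvex k = true then phiEps e p α β (D.ε k) v else phiMaj e p α β (D.ε k) (D.u k) v

/-- The chosen model: `m_k^ε = f_k + φ_{ε_k}` or `m_k = f_k + φ_k`. -/
def mod (k : ℕ) (v : U) : ℝ := D.model k v + D.reg e p α β k v

/-- Predicted reduction. -/
def pred (k : ℕ) : ℝ := D.mod e p α β k (D.u k) - D.mod e p α β k (D.trial k)

/-- Actual reduction. -/
def ared (k : ℕ) : ℝ :=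
  f (D.u k) + D.reg e p α β k (D.u k) - f (D.trial k) - D.reg e p α β k (D.trial k)

/-- The ratio `ρ_k` of computed and predicted reduction. -/
def rho (k : ℕ) : ℝ := D.cred k / D.pred e p α β k

/-- The set of successful iterations. -/
def successful : Set ℕ := {k | D.η₁ ≤ D.rho e p α β k}

/-- Inexact objective condition:
`|ared_k - cred_k| ≤ κ_obj (η min(pred_k, θ_k))^ζ` with `θ_k → 0`. -/
def InexactObjective : Prop :=
  ∃ (κobj η ζ : ℝ) (θ : ℕ → ℝ), 0 ≤ κobj ∧ 1 < ζ ∧ 0 < η ∧ η < min D.η₁ (1 - D.η₂) ∧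
    (∀ k, 0 ≤ θ k) ∧ Tendsto θ atTop (𝓝 0) ∧
    ∀ k, |D.ared e p α β f k - D.cred k| ≤ κobj * (η * min (D.pred e p α β k) (θ k)) ^ ζ

variable [CompleteSpace U]

/-- `h_k = (1/r₀) ‖prox_{r₀ φ_k}(u_k - r₀ ∇f_k(u_k)) - u_k‖`. -/
def h (k : ℕ) : ℝ :=
  proxResidual D.r₀ (phiMaj e p α β (D.ε k) (D.u k)) (∇ (D.model k) (D.u k)) (D.u k)

/-- `ω_k = sup {|ω(f_k, u_k, s)| : 0 < ‖s‖ ≤ κ_rad Δ_k}`. -/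
def omega (k : ℕ) : ℝ :=
  sSup {c | ∃ s : U, 0 < ‖s‖ ∧ ‖s‖ ≤ D.κrad * D.Δ k ∧ c = |curvature (D.model k) (D.u k) s|}

/-- `b_k = 1 + max {ω_i : i = 1, …, k}` for `k ≥ 1`. -/
def b (k : ℕ) : ℝ := 1 + sSup (D.omega '' Set.Icc 1 k)

/-- `D` is an (infinite) run of the algorithm. -/
structure IsRun : Prop where
  r₀_pos : 0 < D.r₀
  η₁_pos : 0 < D.η₁
  η₁_lt_η₂ : D.η₁ < D.η₂
  η₂_lt_one : D.η₂ < 1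
  γ₁_pos : 0 < D.γ₁
  γ₁_le_γ₂ : D.γ₁ ≤ D.γ₂
  γ₂_lt_one : D.γ₂ < 1
  one_le_γ₃ : 1 ≤ D.γ₃
  κfcd_pos : 0 < D.κfcd
  κrad_pos : 0 < D.κrad
  ε_pos : ∀ k, 0 < D.ε k
  ε_antitone : Antitone D.ε
  ε_tendsto : Tendsto D.ε atTop (𝓝 0)
  Δ_zero_pos : 0 < D.Δ 0
  /-- fraction of Cauchy decrease condition -/
  fcd : ∀ k, D.κfcd * D.h e p α β k * min (D.h e p α β k / (1 + D.omega k)) (D.Δ k) ≤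
    D.pred e p α β k
  trial_mem : ∀ k, ‖D.trial k - D.u k‖ ≤ D.κrad * D.Δ k
  reject : ∀ k, D.rho e p α β k < D.η₁ → D.u (k + 1) = D.u k
  accept : ∀ k, D.η₁ ≤ D.rho e p α β k → D.u (k + 1) = D.trial k
  radius_unsuccessful : ∀ k, D.rho e p α β k < D.η₁ →
    D.Δ (k + 1) ∈ Set.Icc (D.γ₁ * D.Δ k) (D.γ₂ * D.Δ k)
  radius_successful : ∀ k, D.η₁ ≤ D.rho e p α β k → D.rho e p α β k < D.η₂ →
    D.Δ (k + 1) ∈ Set.Icc (D.γ₂ * D.Δ k) (D.Δ k)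
  radius_very_successful : ∀ k, D.η₂ ≤ D.rho e p α β k →
    D.Δ (k + 1) ∈ Set.Icc (D.Δ k) (D.γ₃ * D.Δ k)

/-- Inexact gradient condition: every `f_k` is `L_k`-smooth for some `L_k`, and
`‖∇f_k(u_k) - ∇f(u_k)‖ ≤ κ_grad min(h_k, Δ_k)` with `κ_grad` independent of `k`. -/
def InexactGradient : Prop :=
  (∀ k, ∃ L : ℝ≥0, IsLSmooth L (D.model k)) ∧
  ∃ κgrad : ℝ, 0 ≤ κgrad ∧ ∀ k,
    ‖∇ (D.model k) (D.u k) - ∇ f (D.u k)‖ ≤ κgrad * min (D.h e p α β k) (D.Δ k)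

/-- Curvature condition `∑_{k ≥ 1} 1 / b_k = ∞`. -/
def CurvatureCondition : Prop :=
  Tendsto (fun n => ∑ k ∈ Finset.Icc 1 n, 1 / D.b k) atTop atTop

end Data

end SmoothedTR

end

noncomputable section

namespace SmoothedTR

/-! ### The smoothing function -/

/-! The majorant `phiMaj` is a constant plus a nonnegative quadratic form plus `α/2 ‖·‖²`, so the
proximal point `P` at `u` with gradient `g` solves a linear equation (`prox_phiMaj`): `(1/r)⟪P - u,
v⟫ + ⟪g, v⟫ + α⟪P, v⟫ + 2β ∫ ψ'(u²) P v = 0` for all `v`. Everything follows from two choices of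
`v`.

Taking `v = P - u → 0` gives `∫ ψ'(u²) P (P - u) → 0`. Since `P² ≤ u² + 2P(P - u)` and `ψ'(t²) t² ≤
(p/2)|t|^p`, this bounds `∫ ψ'(u²) P²` above by `(p/2) ∫ |u|^p + o(1)`. The matching lower bound is
a Fatou-type argument along a.e. convergent subsequences (`tendsto_integral_weight_sq`). Both use
the compact embedding of `H_0^1(Ω)` into `L²(Ω)`, proved here by averaging over small balls. This is
claim 1.

Taking `v = P` identifies the limit of `α‖P‖²` (`tendsto_norm_prox_sq`). With `λ̄` defined by the
stationarity equation, `⟨λ̄, ū⟩ - p ∫ |ū|^p = (α/β)(lim ‖P‖² - ‖ū‖²)`. This is nonnegative by weak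
lower semicontinuity (claim 3) and zero if the iterates converge strongly (claim 2).

Claim 2 also needs `h_k` to be small infinitely often. After the last success the radii are
summable, while `∑ 1/b_k` diverges, so `b_k Δ_k` is arbitrarily small infinitely often. If `h_k`
stayed away from zero, the model error `O(b_k Δ_k²)` would then be negligible against `pred_k`, and
some later step would be accepted. -/

lemma hasDerivAt_psi {p ε : ℝ} (hε : 0 < ε) (t : ℝ) :
    HasDerivAt (psi p ε) (p / 2 * max t (ε ^ 2) ^ (p / 2 - 1)) t := by
  have hε2 : 0 < ε ^ 2 := by positivity
  have hpow : (ε ^ 2) ^ (p / 2 - 1) = 1 / ε ^ (2 - p) := by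
    rw [← Real.rpow_natCast, ← Real.rpow_mul hε.le, one_div, ← Real.rpow_neg hε.le]
    congr 1
    push_cast
    ring
  have hval : (ε ^ 2) ^ (p / 2) = p / 2 * (ε ^ 2 / ε ^ (2 - p)) + (1 - p / 2) * ε ^ p := by
    have h1 : (ε ^ 2) ^ (p / 2) = ε ^ p := by
      rw [← Real.rpow_natCast, ← Real.rpow_mul hε.le]
      congr 1
      push_cast
      ring
    have h2 : ε ^ 2 / ε ^ (2 - p) = ε ^ p := by
      rw [← Real.rpow_natCast, ← Real.rpow_sub hε]
      congr 1
      push_cast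
      ring
    rw [h1, h2]
    ring
  have haff : ∀ s, HasDerivAt (fun s => p / 2 * (s / ε ^ (2 - p)) + (1 - p / 2) * ε ^ p)
      (p / 2 * (1 / ε ^ (2 - p))) s := fun s =>
    (((hasDerivAt_id s).div_const _).const_mul _).add_const _
  have hpw : ∀ s, 0 < s → HasDerivAt (fun s : ℝ => s ^ (p / 2)) (p / 2 * s ^ (p / 2 - 1)) s :=
    fun s hs => Real.hasDerivAt_rpow_const (Or.inl hs.ne')
  rcases lt_trichotomy t (ε ^ 2) with ht | ht | ht
  · rw [max_eq_right ht.le, hpow]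
    refine (haff t).congr_of_eventuallyEq ?_
    filter_upwards [eventually_lt_nhds ht] with s hs
    simp [psi, hs]
  · subst ht
    -- At the kink the branches agree in value (`hval`) and slope (`hpow`), so the one-sided
    -- derivatives glue.
    rw [max_self, ← hasDerivWithinAt_univ, ← Set.Iic_union_Ici (a := ε ^ 2)]
    refine HasDerivWithinAt.union ?_ ?_
    · rw [hpow]
      refine (haff _).hasDerivWithinAt.congr (fun s hs => ?_) ?_
      · rcases (Set.mem_Iic.1 hs).lt_or_eq with h | h
        · simp [psi, h]
        · simp [psi, h, hval]
      · simp [psi, hval]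
    · refine (hpw _ hε2).hasDerivWithinAt.congr (fun s hs => ?_) ?_
      · simp [psi, not_lt.2 (Set.mem_Ici.1 hs)]
      · simp [psi]
  · rw [max_eq_left ht.le]
    refine (hpw t (hε2.trans ht)).congr_of_eventuallyEq ?_
    filter_upwards [eventually_gt_nhds ht] with s hs
    simp [psi, hs.le]

lemma deriv_psi {p ε : ℝ} (hε : 0 < ε) (t : ℝ) :
    deriv (psi p ε) t = p / 2 * max t (ε ^ 2) ^ (p / 2 - 1) :=
  (hasDerivAt_psi hε t).deriv

lemma continuous_psi {p ε : ℝ} (hε : 0 < ε) : Continuous (psi p ε) :=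
  continuous_iff_continuousAt.2 fun t => (hasDerivAt_psi hε t).continuousAt

lemma deriv_psi_nonneg {p ε : ℝ} (hp : 0 < p) (hε : 0 < ε) (t : ℝ) : 0 ≤ deriv (psi p ε) t := by
  rw [deriv_psi hε]
  positivity

lemma deriv_psi_le {p ε : ℝ} (hp : 0 < p) (hp1 : p < 1) (hε : 0 < ε) (t : ℝ) :
    deriv (psi p ε) t ≤ p / 2 * (ε ^ 2) ^ (p / 2 - 1) := by
  rw [deriv_psi hε]
  gcongr ?_ * ?_
  exact Real.rpow_le_rpow_of_nonpos (by positivity) (le_max_right _ _) (by linarith)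

lemma rpow_half_sq (p a : ℝ) : (a ^ 2) ^ (p / 2) = |a| ^ p := by
  rw [← sq_abs, ← Real.rpow_natCast, ← Real.rpow_mul (abs_nonneg a)]
  congr 1
  push_cast
  ring

/-- The exponent `p/2 - 1` is negative, so dropping `ε²` from the maximum only increases the power.
The bound does not depend on `ε`. -/
lemma deriv_psi_mul_sq_le {p ε : ℝ} (hp : 0 < p) (hp1 : p < 1) (hε : 0 < ε) (a : ℝ) :
    deriv (psi p ε) (a ^ 2) * a ^ 2 ≤ p / 2 * |a| ^ p := by
  rcases eq_or_ne a 0 with rfl | ha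
  · simp [hp.ne']
  have ha2 : 0 < a ^ 2 := by positivity
  calc deriv (psi p ε) (a ^ 2) * a ^ 2
      ≤ p / 2 * (a ^ 2) ^ (p / 2 - 1) * a ^ 2 := by
        rw [deriv_psi hε]
        gcongr ?_ * ?_ * ?_
        exact Real.rpow_le_rpow_of_nonpos ha2 (le_max_left _ _) (by linarith)
    _ = p / 2 * |a| ^ p := by
        rw [mul_assoc, ← Real.rpow_add_one ha2.ne', sub_add_cancel, rpow_half_sq]

lemma abs_psi_le {p ε t : ℝ} (hp : 0 < p) (hp1 : p < 1) (hε : 0 < ε) (ht : 0 ≤ t) :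
    |psi p ε t| ≤ ε ^ p + 1 + t := by
  have hεp : 0 < ε ^ p := by positivity
  unfold psi
  split_ifs with h
  · have h2 : t / ε ^ (2 - p) ≤ ε ^ p := by
      rw [div_le_iff₀ (by positivity), ← Real.rpow_add hε, add_sub_cancel]
      exact_mod_cast h.le
    have h3 : 0 ≤ t / ε ^ (2 - p) := by positivity
    rw [abs_of_nonneg (by nlinarith)]
    nlinarith
  · rw [abs_of_nonneg (by positivity)]
    rcases le_total t 1 with h1 | h1
    · have := Real.rpow_le_one ht h1 (z := p / 2) (by positivity)
      linarith
    · have := Real.rpow_le_rpow_of_exponent_le h1 (show p / 2 ≤ 1 by linarith)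
      rw [Real.rpow_one] at this
      linarith

/-- For `c ≠ 0` the product itself converges. For `c = 0` the weight may blow up and the product
need not converge, but truncation at `(p/2)|c|^p = 0` leaves only zero. -/
lemma tendsto_min_deriv_psi_mul_sq {p : ℝ} (hp : 0 < p) {ε a b : ℕ → ℝ} {c : ℝ}
    (hε : ∀ k, 0 < ε k) (hε0 : Tendsto ε atTop (𝓝 0)) (ha : Tendsto a atTop (𝓝 c))
    (hb : Tendsto b atTop (𝓝 c)) :
    Tendsto (fun k => min (deriv (psi p (ε k)) (b k ^ 2) * a k ^ 2) (p / 2 * |c| ^ p)) atTop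
      (𝓝 (p / 2 * |c| ^ p)) := by
  rcases eq_or_ne c 0 with rfl | hc
  · refine tendsto_nhds_of_eventually_eq (Eventually.of_forall fun k => ?_)
    have := deriv_psi_nonneg hp (hε k) (b k ^ 2)
    rw [abs_zero, Real.zero_rpow hp.ne', mul_zero]
    exact min_eq_right (by positivity)
  · have hc2 : 0 < c ^ 2 := by positivity
    have h1 : Tendsto (fun k => max (b k ^ 2) (ε k ^ 2)) atTop (𝓝 (c ^ 2)) := by
      have := (hb.pow 2).max (hε0.pow 2)
      rwa [zero_pow two_ne_zero, max_eq_left hc2.le] at this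
    have h2 : Tendsto (fun k => deriv (psi p (ε k)) (b k ^ 2) * a k ^ 2) atTop
        (𝓝 (p / 2 * |c| ^ p)) := by
      have h3 : p / 2 * |c| ^ p = p / 2 * (c ^ 2) ^ (p / 2 - 1) * c ^ 2 := by
        rw [mul_assoc, ← Real.rpow_add_one hc2.ne', sub_add_cancel, rpow_half_sq]
      rw [h3]
      simp_rw [fun k => deriv_psi (p := p) (hε k)]
      exact ((h1.rpow_const (Or.inl hc2.ne')).const_mul _).mul (ha.pow 2)
    simpa using h2.min (tendsto_const_nhds (x := p / 2 * |c| ^ p))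

/-! ### Powers with exponent in `(0, 1)` -/

lemma abs_rpow_sub_le {p : ℝ} (hp : 0 < p) (hp1 : p < 1) (a b : ℝ) :
    |(|a| ^ p - |b| ^ p)| ≤ |a - b| ^ p := by
  have key : ∀ a b : ℝ, |a| ^ p - |b| ^ p ≤ |a - b| ^ p := fun a b => by
    have h1 : |a| ≤ |a - b| + |b| := by
      simpa using abs_add_le (a - b) b
    have h2 := Real.rpow_le_rpow (abs_nonneg a) h1 hp.le
    have h3 := Real.rpow_add_le_add_rpow (abs_nonneg (a - b)) (abs_nonneg b) hp.le hp1.le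
    linarith
  rw [abs_le]
  refine ⟨?_, key a b⟩
  have := key b a
  rw [abs_sub_comm] at this
  linarith

/-- Split at `|t| = l`. This controls the `p`-th power by an `L²` quantity up to `l ^ p`, which can
be made as small as desired. -/
lemma abs_rpow_le_add_sq {p l : ℝ} (hp : 0 < p) (hp1 : p < 1) (hl : 0 < l) (t : ℝ) :
    |t| ^ p ≤ l ^ p + l ^ (p - 2) * t ^ 2 := by
  rcases le_total |t| l with h | h
  · have := Real.rpow_le_rpow (abs_nonneg t) h hp.le
    have h2 : 0 ≤ l ^ (p - 2) * t ^ 2 := by positivity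
    linarith
  · have ht : 0 < |t| := hl.trans_le h
    have h1 : |t| ^ p = |t| ^ (p - 2) * t ^ 2 := by
      rw [← sq_abs t, ← Real.rpow_natCast |t| 2, ← Real.rpow_add ht]
      congr 1
      push_cast
      ring
    have h2 : |t| ^ (p - 2) ≤ l ^ (p - 2) :=
      Real.rpow_le_rpow_of_nonpos hl h (by linarith)
    have h3 : 0 ≤ l ^ p := by positivity
    rw [h1]
    nlinarith [sq_nonneg t]

/-! ### Compactness of the embedding `H_0^1(Ω) → L²(Ω)` -/

section Average

open scoped ENNReal

lemma eLpNorm_two_sq_eq_lintegral {X E : Type*} [MeasurableSpace X] [NormedAddCommGroup E]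
    (μ : Measure X) (f : X → E) : eLpNorm f 2 μ ^ 2 = ∫⁻ x, ‖f x‖ₑ ^ 2 ∂μ := by
  have := eLpNorm_nnreal_pow_eq_lintegral (μ := μ) (f := f) (p := 2) two_ne_zero
  simpa using this

lemma sq_lintegral_enorm_le {X E : Type*} [MeasurableSpace X] [NormedAddCommGroup E]
    (μ : Measure X) [IsProbabilityMeasure μ] {f : X → E} (hf : AEStronglyMeasurable f μ) :
    (∫⁻ x, ‖f x‖ₑ ∂μ) ^ 2 ≤ ∫⁻ x, ‖f x‖ₑ ^ 2 ∂μ := by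
  rw [← eLpNorm_two_sq_eq_lintegral, ← eLpNorm_one_eq_lintegral_enorm]
  gcongr
  exact eLpNorm_le_eLpNorm_of_exponent_le one_le_two hf

lemma enorm_integral_sq_le {X E : Type*} [MeasurableSpace X] [NormedAddCommGroup E]
    [NormedSpace ℝ E] (μ : Measure X) [IsProbabilityMeasure μ] {f : X → E}
    (hf : AEStronglyMeasurable f μ) : ‖∫ x, f x ∂μ‖ₑ ^ 2 ≤ ∫⁻ x, ‖f x‖ₑ ^ 2 ∂μ :=
  (pow_le_pow_left' (enorm_integral_le_lintegral_enorm f) 2).trans (sq_lintegral_enorm_le μ hf)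

variable {d : ℕ} {φ : Dom d → ℝ}

/-- Fundamental theorem of calculus along the segment from `x` to `x + h`, then Jensen on the unit
interval. -/
lemma enorm_translate_sub_sq_le (hφ : ContDiff ℝ 1 φ) (x h : Dom d) :
    ‖φ (x + h) - φ x‖ₑ ^ 2 ≤
      ‖h‖ₑ ^ 2 * ∫⁻ t in Set.Ioc (0 : ℝ) 1, ‖fderiv ℝ φ (x + t • h)‖ₑ ^ 2 := by
  have hcont : Continuous fun t : ℝ => fderiv ℝ φ (x + t • h) h := by
    have := hφ.continuous_fderiv one_ne_zero
    fun_prop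
  have hd : ∀ t : ℝ, HasDerivAt (fun t : ℝ => φ (x + t • h)) (fderiv ℝ φ (x + t • h) h) t := by
    intro t
    have h1 : HasDerivAt (fun t : ℝ => x + t • h) h t := by
      simpa using ((hasDerivAt_id t).smul_const h).const_add x
    exact (hφ.differentiable one_ne_zero (x + t • h)).hasFDerivAt.comp_hasDerivAt t h1
  have hftc := intervalIntegral.integral_eq_sub_of_hasDerivAt (a := 0) (b := 1)
    (fun t _ => hd t) (hcont.intervalIntegrable _ _)
  rw [intervalIntegral.integral_of_le zero_le_one, one_smul, zero_smul, add_zero] at hftc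
  have : IsProbabilityMeasure (volume.restrict (Set.Ioc (0 : ℝ) 1)) := ⟨by simp⟩
  rw [← hftc, ← lintegral_const_mul' _ _ (by simp)]
  refine (enorm_integral_sq_le _ hcont.aestronglyMeasurable).trans (lintegral_mono fun t => ?_)
  rw [← mul_pow, mul_comm]
  gcongr
  exact ContinuousLinearMap.le_opENorm _ _

lemma lintegral_translate_sub_sq_le (hφ : ContDiff ℝ 1 φ) (h : Dom d) :
    ∫⁻ x, ‖φ (x + h) - φ x‖ₑ ^ 2 ≤ ‖h‖ₑ ^ 2 * ∫⁻ x, ‖fderiv ℝ φ x‖ₑ ^ 2 := by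
  have hcont := hφ.continuous_fderiv one_ne_zero
  calc ∫⁻ x, ‖φ (x + h) - φ x‖ₑ ^ 2
      ≤ ∫⁻ x, ‖h‖ₑ ^ 2 * ∫⁻ t in Set.Ioc (0 : ℝ) 1, ‖fderiv ℝ φ (x + t • h)‖ₑ ^ 2 :=
        lintegral_mono fun x => enorm_translate_sub_sq_le hφ x h
    _ = ‖h‖ₑ ^ 2 * ∫⁻ t in Set.Ioc (0 : ℝ) 1, ∫⁻ x, ‖fderiv ℝ φ (x + t • h)‖ₑ ^ 2 := by
        rw [lintegral_const_mul' _ _ (by simp), lintegral_lintegral_swap]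
        refine Measurable.aemeasurable ?_
        have : Continuous fun q : Dom d × ℝ => fderiv ℝ φ (q.1 + q.2 • h) := by fun_prop
        exact this.enorm.measurable.pow_const 2
    _ = ‖h‖ₑ ^ 2 * ∫⁻ x, ‖fderiv ℝ φ x‖ₑ ^ 2 := by
        simp_rw [fun t : ℝ => lintegral_add_right_eq_self (μ := (volume : Measure (Dom d)))
          (fun x => ‖fderiv ℝ φ x‖ₑ ^ 2) (t • h)]
        simp

/-- Jensen in the shift and Tonelli reduce this to the translation estimate for each fixed shift of
length at most `δ`. -/
lemma lintegral_sub_average_sq_le (hφ : ContDiff ℝ 1 φ) (hc : HasCompactSupport φ)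
    {δ : ℝ} (ν : Measure (Dom d)) [IsProbabilityMeasure ν]
    (hν : ∀ᵐ h ∂ν, ‖h‖ ≤ δ) :
    ∫⁻ x, ‖φ x - ∫ h, φ (x + h) ∂ν‖ₑ ^ 2 ≤
      ENNReal.ofReal δ ^ 2 * ∫⁻ x, ‖fderiv ℝ φ x‖ₑ ^ 2 := by
  have hφc := hφ.continuous
  have hint : ∀ x, Integrable (fun h => φ (x + h)) ν := fun x => by
    obtain ⟨C, hC⟩ := hc.exists_bound_of_continuous hφc
    exact Integrable.of_bound (by fun_prop) C (Eventually.of_forall fun h => hC _)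
  calc ∫⁻ x, ‖φ x - ∫ h, φ (x + h) ∂ν‖ₑ ^ 2
      ≤ ∫⁻ x, (∫⁻ h, ‖φ (x + h) - φ x‖ₑ ^ 2 ∂ν) := by
        refine lintegral_mono fun x => ?_
        have : φ x - ∫ h, φ (x + h) ∂ν = -∫ h, (φ (x + h) - φ x) ∂ν := by
          rw [integral_sub (hint x) (integrable_const _)]
          simp
        rw [this, enorm_neg]
        exact enorm_integral_sq_le ν (by fun_prop)
    _ = ∫⁻ h, (∫⁻ x, ‖φ (x + h) - φ x‖ₑ ^ 2) ∂ν := by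
        refine lintegral_lintegral_swap (Measurable.aemeasurable ?_)
        have : Continuous fun q : Dom d × Dom d => φ (q.1 + q.2) - φ q.1 := by fun_prop
        exact this.enorm.measurable.pow_const 2
    _ ≤ ∫⁻ _, (ENNReal.ofReal δ ^ 2 * ∫⁻ x, ‖fderiv ℝ φ x‖ₑ ^ 2) ∂ν := by
        refine lintegral_mono_ae ?_
        filter_upwards [hν] with h hh
        refine (lintegral_translate_sub_sq_le hφ h).trans ?_
        gcongr
        rw [← ofReal_norm]
        exact ENNReal.ofReal_le_ofReal hh
    _ = _ := by simp

lemma enorm_sq_le_two_mul (a b : ℝ) : ‖a‖ₑ ^ 2 ≤ 2 * ‖a - b‖ₑ ^ 2 + 2 * ‖b‖ₑ ^ 2 := by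
  have h1 : ‖a‖ₑ ≤ ‖a - b‖ₑ + ‖b‖ₑ := by simpa using enorm_add_le (a - b) b
  have h2 := ENNReal.rpow_add_le_mul_rpow_add_rpow ‖a - b‖ₑ ‖b‖ₑ one_le_two
  norm_num at h2
  rw [← mul_add]
  exact (pow_le_pow_left' h1 2).trans h2

lemma exists_pos_ofReal_sq_mul_lt {M c : ℝ≥0∞} (hM : M ≠ ⊤) (hc : 0 < c) :
    ∃ δ : ℝ, 0 < δ ∧ 2 * (ENNReal.ofReal δ ^ 2 * M) < c := by
  have hlim : Tendsto (fun δ : ℝ => 2 * (ENNReal.ofReal δ ^ 2 * M)) (𝓝[>] 0) (𝓝 0) := by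
    have h2 : Tendsto (fun δ : ℝ => ENNReal.ofReal δ ^ 2) (𝓝[>] 0) (𝓝 0) := by
      have := ((ENNReal.continuous_pow 2).comp ENNReal.continuous_ofReal).tendsto 0
      simp only [Function.comp_apply, ENNReal.ofReal_zero, zero_pow two_ne_zero] at this
      exact this.mono_left nhdsWithin_le_nhds
    simpa using ENNReal.Tendsto.const_mul
      (ENNReal.Tendsto.mul_const h2 (Or.inr hM)) (Or.inr ENNReal.ofNat_ne_top)
  have hev := hlim.eventually_lt_const hc
  obtain ⟨δ, h, hδ⟩ := (hev.and self_mem_nhdsWithin).exists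
  exact ⟨δ, hδ, h⟩

lemma average_eq_setIntegral (B : Set (Dom d)) (c : ℝ≥0∞) (x : Dom d) :
    ∫ h, φ (x + h) ∂(c • volume.restrict B) =
      c.toReal * ∫ y in (fun y => -x + y) ⁻¹' B, φ y := by
  have h3 := (measurePreserving_add_left volume x).setIntegral_preimage_emb
    (measurableEmbedding_addLeft x) φ ((fun y => -x + y) ⁻¹' B)
  have h4 : (fun y => x + y) ⁻¹' ((fun y => -x + y) ⁻¹' B) = B := by
    ext h
    rw [Set.mem_preimage, Set.mem_preimage, neg_add_cancel_left]
  rw [h4] at h3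
  rw [integral_smul_measure, smul_eq_mul, h3]

/-- A sequence of test functions on a bounded set that is bounded in `H¹` and whose integrals over
measurable subsets tend to zero converges to zero in `L²`. -/
lemma tendsto_lintegral_sq_of_setIntegral {Ω : Set (Dom d)}
    (hΩ_bdd : Bornology.IsBounded Ω) {φ : ℕ → Dom d → ℝ} (hφ : ∀ k, IsTestFunction Ω (φ k))
    {M : ℝ≥0∞} (hM : M ≠ ⊤) (h0 : ∀ k, ∫⁻ x, ‖φ k x‖ₑ ^ 2 ≤ M)
    (h1 : ∀ k, ∫⁻ x, ‖fderiv ℝ (φ k) x‖ₑ ^ 2 ≤ M)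
    (hw : ∀ S, MeasurableSet S → Tendsto (fun k => ∫ x in S, φ k x) atTop (𝓝 0)) :
    Tendsto (fun k => ∫⁻ x, ‖φ k x‖ₑ ^ 2) atTop (𝓝 0) := by
  have hC1 : ∀ k, ContDiff ℝ 1 (φ k) := fun k => (hφ k).1.of_le (by exact_mod_cast le_top)
  have hcont : ∀ k, Continuous (φ k) := fun k => (hC1 k).continuous
  have hsupp : ∀ k x, x ∉ Ω → φ k x = 0 := fun k x hx =>
    image_eq_zero_of_notMem_tsupport fun h => hx ((hφ k).2.2 h)
  have hΩ_fin : volume Ω ≠ ⊤ := hΩ_bdd.measure_lt_top.ne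
  rw [ENNReal.tendsto_nhds_zero]
  intro c hc
  -- The radius makes the averaging error at most `c/2` for all `k` at once. For this fixed radius
  -- the averages `A k` tend to zero pointwise and are uniformly bounded, so dominated convergence
  -- on the finite-measure set `Ω` handles them.
  obtain ⟨δ, hδ, hδM⟩ := exists_pos_ofReal_sq_mul_lt hM (ENNReal.half_pos hc.ne')
  let B : Set (Dom d) := Metric.ball 0 δ
  have hB0 : volume B ≠ 0 := (Metric.measure_ball_pos volume _ hδ).ne'
  have hBt : volume B ≠ ⊤ := measure_ball_lt_top.ne
  let ν : Measure (Dom d) := (volume B)⁻¹ • volume.restrict B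
  have : IsProbabilityMeasure ν := ⟨by simp [ν, ENNReal.inv_mul_cancel hB0 hBt]⟩
  have hν : ∀ᵐ h ∂ν, ‖h‖ ≤ δ := by
    refine Measure.ae_smul_measure ?_ _
    filter_upwards [ae_restrict_mem Metric.isOpen_ball.measurableSet] with h hh
    exact (mem_ball_zero_iff.1 hh).le
  let A : ℕ → Dom d → ℝ := fun k x => ∫ h, φ k (x + h) ∂ν
  have hAmeas : ∀ k, Measurable fun x => ‖A k x‖ₑ ^ 2 := fun k => by
    have h2 : Continuous fun q : Dom d × Dom d => φ k (q.1 + q.2) := by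
      have := hcont k
      fun_prop
    exact (StronglyMeasurable.integral_prod_right
      h2.stronglyMeasurable).measurable.enorm.pow_const 2
  have hAbd : ∀ k x, ‖A k x‖ₑ ^ 2 ≤ (volume B)⁻¹ * M := fun k x => by
    have h2 : AEStronglyMeasurable (fun h => φ k (x + h)) ν := by
      have := hcont k
      fun_prop
    refine (enorm_integral_sq_le ν h2).trans ?_
    rw [lintegral_smul_measure, smul_eq_mul]
    gcongr
    calc ∫⁻ h in B, ‖φ k (x + h)‖ₑ ^ 2 ≤ ∫⁻ h, ‖φ k (x + h)‖ₑ ^ 2 := setLIntegral_le_lintegral _ _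
      _ = ∫⁻ h, ‖φ k h‖ₑ ^ 2 := lintegral_add_left_eq_self (fun y => ‖φ k y‖ₑ ^ 2) x
      _ ≤ M := h0 k
  have hAlim : ∀ x, Tendsto (fun k => ‖A k x‖ₑ ^ 2) atTop (𝓝 0) := fun x => by
    have h2 : Tendsto (fun k => A k x) atTop (𝓝 0) := by
      have h3 := (hw ((fun y => -x + y) ⁻¹' B)
        (measurable_const_add (-x) Metric.isOpen_ball.measurableSet)).const_mul
        (volume B)⁻¹.toReal
      rw [mul_zero] at h3
      exact h3.congr fun k => (average_eq_setIntegral B _ x).symm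
    have h3 := ((ENNReal.continuous_pow 2).tendsto _).comp h2.enorm
    rw [enorm_zero, zero_pow two_ne_zero] at h3
    exact h3
  have hDCT : Tendsto (fun k => 2 * ∫⁻ x in Ω, ‖A k x‖ₑ ^ 2) atTop (𝓝 0) := by
    have h2 := tendsto_lintegral_of_dominated_convergence (μ := volume.restrict Ω)
      (fun _ => (volume B)⁻¹ * M) hAmeas (fun k => Eventually.of_forall (hAbd k))
      (by simpa using ENNReal.mul_ne_top (ENNReal.mul_ne_top (ENNReal.inv_ne_top.2 hB0) hM) hΩ_fin)
      (Eventually.of_forall hAlim)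
    simpa using ENNReal.Tendsto.const_mul h2 (Or.inr ENNReal.ofNat_ne_top)
  filter_upwards [hDCT.eventually_lt_const (ENNReal.half_pos hc.ne')] with k hk
  calc ∫⁻ x, ‖φ k x‖ₑ ^ 2 = ∫⁻ x in Ω, ‖φ k x‖ₑ ^ 2 := by
        refine (setLIntegral_eq_of_support_subset fun x hx => ?_).symm
        by_contra hxΩ
        exact hx (by simp [hsupp k x hxΩ])
    _ ≤ ∫⁻ x in Ω, (2 * ‖φ k x - A k x‖ₑ ^ 2 + 2 * ‖A k x‖ₑ ^ 2) :=
        lintegral_mono fun x => enorm_sq_le_two_mul _ _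
    _ = 2 * (∫⁻ x in Ω, ‖φ k x - A k x‖ₑ ^ 2) + 2 * ∫⁻ x in Ω, ‖A k x‖ₑ ^ 2 := by
        rw [lintegral_add_right _ ((hAmeas k).const_mul 2), lintegral_const_mul' _ _ (by simp),
          lintegral_const_mul' _ _ (by simp)]
    _ ≤ c / 2 + c / 2 := by
        gcongr
        refine le_trans ?_ hδM.le
        gcongr
        calc ∫⁻ x in Ω, ‖φ k x - A k x‖ₑ ^ 2 ≤ ∫⁻ x, ‖φ k x - A k x‖ₑ ^ 2 :=
              setLIntegral_le_lintegral _ _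
          _ ≤ ENNReal.ofReal δ ^ 2 * ∫⁻ x, ‖fderiv ℝ (φ k) x‖ₑ ^ 2 :=
              lintegral_sub_average_sq_le (hC1 k) (hφ k).2.1 ν hν
          _ ≤ _ := by gcongr; exact h1 k
    _ = c := ENNReal.add_halves c

end Average

variable {d : ℕ} {Ω : Set (Dom d)}

lemma enorm_sq_eq_lintegral_of_ae_eq {E : Type*} [NormedAddCommGroup E]
    {w : Lp E 2 (volume.restrict Ω)} {g : Dom d → E} (hg : (w : Dom d → E) =ᵐ[volume.restrict Ω] g)
    (h0 : ∀ x ∉ Ω, g x = 0) :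
    ‖w‖ₑ ^ 2 = ∫⁻ x, ‖g x‖ₑ ^ 2 := by
  rw [Lp.enorm_def, eLpNorm_congr_ae hg, eLpNorm_two_sq_eq_lintegral]
  refine setLIntegral_eq_of_support_subset fun x hx => ?_
  by_contra hxΩ
  exact hx (by simp [h0 x hxΩ])

lemma norm_fst_le (w : GraphSpace Ω) : ‖w.fst‖ ≤ ‖w‖ := by
  refine le_of_sq_le_sq ?_ (norm_nonneg _)
  rw [WithLp.prod_norm_sq_eq_of_L2]
  nlinarith [sq_nonneg ‖w.snd‖]

lemma norm_snd_le (w : GraphSpace Ω) : ‖w.snd‖ ≤ ‖w‖ := by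
  refine le_of_sq_le_sq ?_ (norm_nonneg _)
  rw [WithLp.prod_norm_sq_eq_of_L2]
  nlinarith [sq_nonneg ‖w.fst‖]

/-- Test functions and their gradients vanish off `Ω`, so norms over `Ω` are integrals over the
whole space, where translation is available. Weak convergence is used only against indicator
functions. -/
lemma tendsto_norm_fst_of_testGraph (hΩ : MeasurableSet Ω) (hΩ_bdd : Bornology.IsBounded Ω)
    {v : ℕ → GraphSpace Ω} (hv : ∀ k, v k ∈ testGraph Ω) {M : ℝ} (hM : ∀ k, ‖v k‖ ≤ M)
    (hw : ∀ g : Lp ℝ 2 (volume.restrict Ω), Tendsto (fun k => ⟪g, (v k).fst⟫) atTop (𝓝 0)) :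
    Tendsto (fun k => ‖(v k).fst‖) atTop (𝓝 0) := by
  choose φ hφ h0 h1 using hv
  have hsupp : ∀ k x, x ∉ Ω → φ k x = 0 := fun k x hx =>
    image_eq_zero_of_notMem_tsupport fun h => hx ((hφ k).2.2 h)
  have hsupp' : ∀ k x, x ∉ Ω → ∇ (φ k) x = 0 := fun k x hx => by
    have : fderiv ℝ (φ k) x = 0 :=
      image_eq_zero_of_notMem_tsupport fun h => hx ((hφ k).2.2 (tsupport_fderiv_subset ℝ h))
    simp [gradient, this]
  have e0 : ∀ k, ‖(v k).fst‖ₑ ^ 2 = ∫⁻ x, ‖φ k x‖ₑ ^ 2 := fun k =>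
    enorm_sq_eq_lintegral_of_ae_eq (h0 k) (hsupp k)
  have e1 : ∀ k, ‖(v k).snd‖ₑ ^ 2 = ∫⁻ x, ‖fderiv ℝ (φ k) x‖ₑ ^ 2 := fun k => by
    rw [enorm_sq_eq_lintegral_of_ae_eq (h1 k) (hsupp' k)]
    simp [gradient]
  have hbd : ∀ (E : Type) [NormedAddCommGroup E] (a : E), ‖a‖ ≤ M →
      ‖a‖ₑ ^ 2 ≤ ENNReal.ofReal M ^ 2 := by
    intro E _ a ha
    gcongr
    rw [← ofReal_norm]
    exact ENNReal.ofReal_le_ofReal ha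
  have hΩ_fin : volume Ω ≠ ⊤ := hΩ_bdd.measure_lt_top.ne
  have key := tendsto_lintegral_sq_of_setIntegral hΩ_bdd hφ (M := ENNReal.ofReal M ^ 2)
    (by simp) (fun k => e0 k ▸ hbd _ _ ((norm_fst_le _).trans (hM k)))
    (fun k => e1 k ▸ hbd _ _ ((norm_snd_le _).trans (hM k))) ?_
  · simp_rw [← e0] at key
    have h2 := ((ENNReal.continuous_rpow_const (y := 2⁻¹)).tendsto 0).comp key
    have h3 : Tendsto (fun k => ‖(v k).fst‖ₑ) atTop (𝓝 0) := by
      refine (h2.congr fun k => ?_).trans_eq ?_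
      · change (‖(v k).fst‖ₑ ^ 2) ^ (2⁻¹ : ℝ) = _
        rw [← ENNReal.rpow_natCast, ← ENNReal.rpow_mul]
        norm_num
      · rw [ENNReal.zero_rpow_of_pos (by norm_num)]
    refine ((ENNReal.tendsto_toReal ENNReal.zero_ne_top).comp h3).congr fun k => ?_
    exact toReal_enorm _
  · intro S hS
    have hSt : (volume.restrict Ω) S ≠ ⊤ :=
      ((measure_mono (Set.subset_univ S)).trans_lt (by simpa [lt_top_iff_ne_top] using hΩ_fin)).ne
    refine (hw (indicatorConstLp 2 hS hSt 1)).congr fun k => ?_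
    rw [L2.inner_indicatorConstLp_one, integral_congr_ae (ae_restrict_of_ae (h0 k)),
      Measure.restrict_restrict hS, Set.inter_comm, ← Measure.restrict_restrict hΩ]
    exact setIntegral_eq_integral_of_forall_compl_eq_zero (hsupp k)

/-- Weakly convergent sequences in `H_0^1(Ω)` converge strongly in `L²(Ω)`. -/
lemma tendsto_norm_fst (hΩ : MeasurableSet Ω) (hΩ_bdd : Bornology.IsBounded Ω)
    {w : ℕ → H01 Ω} {M : ℝ} (hM : ∀ k, ‖w k‖ ≤ M)
    (hw : ∀ g : Lp ℝ 2 (volume.restrict Ω),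
      Tendsto (fun k => ⟪g, (w k : GraphSpace Ω).fst⟫) atTop (𝓝 0)) :
    Tendsto (fun k => ‖(w k : GraphSpace Ω).fst‖) atTop (𝓝 0) := by
  -- Replacing `w k` by a test function with vanishing error preserves both boundedness and the weak
  -- limit.
  have hex : ∀ k : ℕ, ∃ v ∈ testGraph Ω, ‖(w k : GraphSpace Ω) - v‖ < 1 / ((k : ℝ) + 1) := by
    intro k
    obtain ⟨v, hv, h⟩ := Metric.mem_closure_iff.1 (w k).2 (1 / ((k : ℝ) + 1)) (by positivity)
    exact ⟨v, hv, by rwa [← dist_eq_norm]⟩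
  choose v hv hvw using hex
  have hdiff : Tendsto (fun k => ‖((w k : GraphSpace Ω) - v k).fst‖) atTop (𝓝 0) :=
    squeeze_zero (fun _ => norm_nonneg _) (fun k => (norm_fst_le _).trans (hvw k).le)
      tendsto_one_div_add_atTop_nhds_zero_nat
  have hvM : ∀ k, ‖v k‖ ≤ M + 1 := fun k => by
    have h1 : ‖v k‖ ≤ ‖(w k : GraphSpace Ω)‖ + ‖(w k : GraphSpace Ω) - v k‖ := by
      simpa using norm_sub_le (w k : GraphSpace Ω) ((w k : GraphSpace Ω) - v k)
    have h2 : 1 / ((k : ℝ) + 1) ≤ 1 := by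
      rw [div_le_one (by positivity)]
      linarith [(Nat.cast_nonneg k : (0 : ℝ) ≤ k)]
    have h3 : ‖(w k : GraphSpace Ω)‖ ≤ M := hM k
    linarith [hvw k]
  have h0 := tendsto_norm_fst_of_testGraph hΩ hΩ_bdd hv hvM fun g => by
    have h1 : Tendsto (fun k => ⟪g, ((w k : GraphSpace Ω) - v k).fst⟫) atTop (𝓝 0) := by
      refine squeeze_zero_norm (fun k => norm_inner_le_norm _ _) ?_
      simpa using hdiff.const_mul ‖g‖
    have h2 := (hw g).sub h1
    rw [sub_zero] at h2
    refine h2.congr fun k => ?_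
    rw [WithLp.sub_fst, inner_sub_right]
    ring
  refine squeeze_zero (fun _ => norm_nonneg _) (fun k => ?_) (by simpa using h0.add hdiff)
  simpa using norm_add_le (v k).fst ((w k : GraphSpace Ω).fst - (v k).fst)

/-! ### The weighted bilinear form and the proximal point -/

section Form

variable {d : ℕ} {Ω : Set (Dom d)} {U : Type*} [NormedAddCommGroup U] [InnerProductSpace ℝ U]
  (e : U ≃L[ℝ] H01 Ω)

/-- The inclusion of `U = H_0^1(Ω)` into `L²(Ω)`. -/
def toL2 : U →L[ℝ] Lp ℝ 2 (volume.restrict Ω) :=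
  (WithLp.fstL 2 ℝ (Lp ℝ 2 (volume.restrict Ω)) (Lp (Dom d) 2 (volume.restrict Ω))).comp
    ((testGraph Ω).topologicalClosure.subtypeL.comp (e : U →L[ℝ] H01 Ω))

lemma coeFn_toL2 (u : U) : (toL2 e u : Dom d → ℝ) = (e u).fn := rfl

lemma memLp_fn (u : U) : MemLp (e u).fn 2 (volume.restrict Ω) := Lp.memLp (toL2 e u)

lemma integrable_fn_sq (u : U) : IntegrableOn (fun x => (e u).fn x ^ 2) Ω :=
  (memLp_fn e u).integrable_sq

lemma aestronglyMeasurable_fn (u : U) : AEStronglyMeasurable (e u).fn (volume.restrict Ω) :=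
  (memLp_fn e u).1

lemma fn_sub (u v : U) : (e (u - v)).fn =ᵐ[volume.restrict Ω] (e u).fn - (e v).fn := by
  rw [← coeFn_toL2, map_sub]
  exact Lp.coeFn_sub _ _

lemma norm_toL2_sq (u : U) : ‖toL2 e u‖ ^ 2 = ∫ x in Ω, (e u).fn x ^ 2 := by
  rw [← real_inner_self_eq_norm_sq, L2.inner_def]
  simp [coeFn_toL2, pow_two]

variable {p ε : ℝ}

lemma measurable_weight (w : U) :
    AEStronglyMeasurable (fun x => deriv (psi p ε) ((e w).fn x ^ 2)) (volume.restrict Ω) :=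
  ((measurable_deriv (psi p ε)).comp_aemeasurable
    ((aestronglyMeasurable_fn e w).aemeasurable.pow_const 2)).aestronglyMeasurable

lemma norm_weight_le (hp : 0 < p) (hp1 : p < 1) (hε : 0 < ε) (t : ℝ) :
    ‖deriv (psi p ε) t‖ ≤ p / 2 * (ε ^ 2) ^ (p / 2 - 1) := by
  rw [Real.norm_of_nonneg (deriv_psi_nonneg hp hε t)]
  exact deriv_psi_le hp hp1 hε t

lemma integrable_weight_mul (hp : 0 < p) (hp1 : p < 1) (hε : 0 < ε) (w : U) {g : Dom d → ℝ}
    (hg : IntegrableOn g Ω) :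
    IntegrableOn (fun x => deriv (psi p ε) ((e w).fn x ^ 2) * g x) Ω :=
  Integrable.bdd_mul hg (measurable_weight e w)
    (Eventually.of_forall fun _ => norm_weight_le hp hp1 hε _)

/-- `∫_Ω ψ_ε'(w²) a b` as a continuous bilinear form. -/
lemma exists_weightedForm (hp : 0 < p) (hp1 : p < 1) (hε : 0 < ε) (w : U) :
    ∃ Q : U →L[ℝ] U →L[ℝ] ℝ, ∀ a b, Q a b =
      ∫ x in Ω, deriv (psi p ε) ((e w).fn x ^ 2) * ((e a).fn x * (e b).fn x) := by
  have hm : MemLp (fun x => deriv (psi p ε) ((e w).fn x ^ 2)) ⊤ (volume.restrict Ω) :=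
    memLp_top_of_bound (measurable_weight e w) _
      (Eventually.of_forall fun _ => norm_weight_le hp hp1 hε _)
  let T : Lp ℝ 2 (volume.restrict Ω) →L[ℝ] Lp ℝ 2 (volume.restrict Ω) :=
    (ContinuousLinearMap.mul ℝ ℝ).holderL (volume.restrict Ω) ⊤ 2 2 hm.toLp
  refine ⟨(innerSL ℝ).bilinearComp (T.comp (toL2 e)) (toL2 e), fun a b => ?_⟩
  change ⟪T (toL2 e a), toL2 e b⟫ = _
  rw [L2.inner_def]
  refine integral_congr_ae ?_
  filter_upwards [(ContinuousLinearMap.mul ℝ ℝ).coeFn_holder (r := 2) hm.toLp (toL2 e a),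
    hm.coeFn_toLp] with x h1 h2
  have h3 : (T (toL2 e a) : Dom d → ℝ) x =
      deriv (psi p ε) ((e w).fn x ^ 2) * (e a).fn x := by
    rw [← h2]
    exact h1
  rw [h3, coeFn_toL2]
  simp only [RCLike.inner_apply, conj_trivial]
  ring

lemma integrable_psi (hΩ_bdd : Bornology.IsBounded Ω) (hp : 0 < p) (hp1 : p < 1) (hε : 0 < ε)
    (w : U) : IntegrableOn (fun x => psi p ε ((e w).fn x ^ 2)) Ω := by
  have : IsFiniteMeasure (volume.restrict Ω) := ⟨by simpa using hΩ_bdd.measure_lt_top⟩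
  refine Integrable.mono' ((integrable_const (ε ^ p + 1)).add (integrable_fn_sq e w)) ?_ ?_
  · exact (continuous_psi hε).comp_aestronglyMeasurable ((aestronglyMeasurable_fn e w).pow 2)
  · exact Eventually.of_forall fun x => abs_psi_le hp hp1 hε (sq_nonneg _)

lemma jMaj_eq (hΩ_bdd : Bornology.IsBounded Ω) (hp : 0 < p) (hp1 : p < 1) (hε : 0 < ε)
    (w v : U) :
    jMaj e p ε w v =
      (∫ x in Ω, (psi p ε ((e w).fn x ^ 2) -
        deriv (psi p ε) ((e w).fn x ^ 2) * (e w).fn x ^ 2)) +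
      ∫ x in Ω, deriv (psi p ε) ((e w).fn x ^ 2) * ((e v).fn x * (e v).fn x) := by
  rw [jMaj, ← integral_add]
  · congr with x
    ring
  · exact (integrable_psi e hΩ_bdd hp hp1 hε w).sub
      (integrable_weight_mul e hp hp1 hε w (integrable_fn_sq e w))
  · refine integrable_weight_mul e hp hp1 hε w ?_
    simpa [pow_two] using integrable_fn_sq e v

/-- The majorant `φ_k` is a quadratic functional. -/
lemma exists_phiMaj_eq (hΩ_bdd : Bornology.IsBounded Ω) (hp : 0 < p) (hp1 : p < 1) (hε : 0 < ε)
    {α β : ℝ} (w : U) : ∃ (Q : U →L[ℝ] U →L[ℝ] ℝ) (K : ℝ),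
      (∀ a b, Q a b = Q b a) ∧ (∀ a, 0 ≤ Q a a) ∧
      (∀ v, phiMaj e p α β ε w v = K + β * Q v v + α / 2 * ‖v‖ ^ 2) ∧
      ∀ a b, Q a b =
        ∫ x in Ω, deriv (psi p ε) ((e w).fn x ^ 2) * ((e a).fn x * (e b).fn x) := by
  obtain ⟨Q, hQ⟩ := exists_weightedForm e hp hp1 hε w
  refine ⟨Q, β * ∫ x in Ω, (psi p ε ((e w).fn x ^ 2) -
    deriv (psi p ε) ((e w).fn x ^ 2) * (e w).fn x ^ 2), fun a b => ?_, fun a => ?_, fun v => ?_, hQ⟩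
  · rw [hQ, hQ]
    congr with x
    ring
  · rw [hQ]
    exact integral_nonneg fun x => mul_nonneg (deriv_psi_nonneg hp hε _) (mul_self_nonneg _)
  · have h := jMaj_eq e hΩ_bdd hp hp1 hε w v
    rw [← hQ] at h
    rw [phiMaj, h]
    ring

/-- A real quadratic polynomial without constant term that is nonnegative has no linear term. -/
lemma eq_zero_of_forall_quadratic_nonneg {b c : ℝ} (h : ∀ t : ℝ, 0 ≤ t * b + t ^ 2 * c) :
    b = 0 := by
  have hd := discrim_le_zero (a := c) (b := b) (c := 0) fun t => by
    have := h t
    linarith [pow_two t]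
  simp only [discrim, mul_zero, sub_zero] at hd
  exact pow_eq_zero_iff two_ne_zero |>.1 (le_antisymm hd (sq_nonneg b))

/-- Optimality condition of the proximal problem for a quadratic functional, and existence of its
solution. -/
lemma prox_quadratic [CompleteSpace U] {r a : ℝ} (hr : 0 < r) (ha : 0 < a)
    {Q : U →L[ℝ] U →L[ℝ] ℝ} (hQ : ∀ u v, Q u v = Q v u) (hQ0 : ∀ u, 0 ≤ Q u u)
    {Φ : U → ℝ} {K : ℝ} (hΦ : ∀ v, Φ v = K + Q v v + a / 2 * ‖v‖ ^ 2) (z v : U) :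
    1 / r * ⟪prox r Φ z - z, v⟫ + a * ⟪prox r Φ z, v⟫ + 2 * Q (prox r Φ z) v = 0 := by
  have hexp : ∀ y s : U, 1 / (2 * r) * ‖y + s - z‖ ^ 2 + Φ (y + s) =
      1 / (2 * r) * ‖y - z‖ ^ 2 + Φ y + (1 / r * ⟪y - z, s⟫ + a * ⟪y, s⟫ + 2 * Q y s) +
        ((1 / (2 * r) + a / 2) * ‖s‖ ^ 2 + Q s s) := by
    intro y s
    have h1 : y + s - z = (y - z) + s := by abel
    rw [h1, hΦ, hΦ, norm_add_sq_real, norm_add_sq_real]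
    simp only [map_add, _root_.add_apply]
    rw [hQ s y]
    field_simp
    ring
  -- Lax–Milgram solves the stationarity equation; the second-order remainder in `hexp` is
  -- nonnegative, so the solution is a minimizer. Only then does `Classical.epsilon` carry
  -- information.
  have hmin : ∃ y, IsProx r Φ z y := by
    let I : U →L[ℝ] U →L[ℝ] ℝ := innerSL ℝ
    let B : U →L[ℝ] U →L[ℝ] ℝ := (1 / r + a) • I + (2 : ℝ) • Q
    have hB : ∀ u v, B u v = (1 / r + a) * ⟪u, v⟫ + 2 * Q u v := fun u v => rfl
    have hco : IsCoercive B := ⟨1 / r + a, by positivity, fun u => by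
      rw [hB, real_inner_self_eq_norm_sq]
      nlinarith [hQ0 u]⟩
    let y : U := hco.continuousLinearEquivOfBilin.symm ((1 / r) • z)
    have hy : ∀ s, B y s = 1 / r * ⟪z, s⟫ := fun s => by
      rw [← hco.continuousLinearEquivOfBilin_apply]
      simp [y, real_inner_smul_left]
    refine ⟨y, fun w => ?_⟩
    have h1 := hexp y (w - y)
    rw [add_sub_cancel] at h1
    have h2 : 1 / r * ⟪y - z, w - y⟫ + a * ⟪y, w - y⟫ + 2 * Q y (w - y) = 0 := by
      have := hy (w - y)
      rw [hB] at this
      rw [inner_sub_left]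
      linarith
    have h3 : 0 ≤ (1 / (2 * r) + a / 2) * ‖w - y‖ ^ 2 := by positivity
    linarith [hQ0 (w - y)]
  have hP : IsProx r Φ z (prox r Φ z) := Classical.epsilon_spec hmin
  refine eq_zero_of_forall_quadratic_nonneg (c := (1 / (2 * r) + a / 2) * ‖v‖ ^ 2 + Q v v)
    fun t => ?_
  have h1 := hP (prox r Φ z + t • v)
  rw [hexp] at h1
  simp only [map_smul, _root_.smul_apply, smul_eq_mul, inner_smul_right, norm_smul,
    mul_pow, Real.norm_eq_abs, sq_abs] at h1
  linarith

/-- Variational equation for the proximal point of the majorant. -/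
lemma prox_phiMaj [CompleteSpace U] (hΩ_bdd : Bornology.IsBounded Ω) (hp : 0 < p) (hp1 : p < 1)
    (hε : 0 < ε) {α β r : ℝ} (hα : 0 < α) (hβ : 0 < β) (hr : 0 < r) (w g v : U) :
    1 / r * ⟪prox r (phiMaj e p α β ε w) (w - r • g) - w, v⟫ + ⟪g, v⟫ +
      α * ⟪prox r (phiMaj e p α β ε w) (w - r • g), v⟫ +
      β * (2 * ∫ x in Ω, deriv (psi p ε) ((e w).fn x ^ 2) *
        ((e (prox r (phiMaj e p α β ε w) (w - r • g))).fn x * (e v).fn x)) = 0 := by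
  obtain ⟨Q, K, hsymm, hnonneg, hΦ, hQ⟩ := exists_phiMaj_eq (α := α) (β := β) e hΩ_bdd hp hp1 hε w
  rw [← hQ]
  generalize phiMaj e p α β ε w = Φ at hΦ ⊢
  have h := prox_quadratic hr hα (Q := β • Q) (fun a b => congrArg (β * ·) (hsymm a b))
    (fun a => mul_nonneg hβ.le (hnonneg a)) hΦ (w - r • g) v
  have h2 : (β • Q) (prox r Φ (w - r • g)) v = β * Q (prox r Φ (w - r • g)) v := rfl
  have h3 : prox r Φ (w - r • g) - (w - r • g) = prox r Φ (w - r • g) - w + r • g := by abel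
  rw [h2, h3, inner_add_left, real_inner_smul_left, mul_add, ← mul_assoc,
    one_div_mul_cancel hr.ne'] at h
  linarith

end Form

/-! ### Weakly convergent sequences -/

section Weak

variable {U : Type*} [NormedAddCommGroup U] [InnerProductSpace ℝ U] {u : ℕ → U} {a : U}

lemma WeaklyTendsto.apply (h : WeaklyTendsto u a) (l : StrongDual ℝ U) :
    Tendsto (fun k => l (u k)) atTop (𝓝 (l a)) :=
  ((WeakBilin.eval_continuous (topDualPairing ℝ U).flip l).tendsto _).comp h

lemma WeaklyTendsto.inner (h : WeaklyTendsto u a) (v : U) :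
    Tendsto (fun k => ⟪v, u k⟫) atTop (𝓝 ⟪v, a⟫) :=
  h.apply (innerSL ℝ v)

lemma WeaklyTendsto.norm_le [CompleteSpace U] (h : WeaklyTendsto u a) : ∃ M, ∀ k, ‖u k‖ ≤ M := by
  obtain ⟨C, hC⟩ := banach_steinhaus (g := fun k => innerSL ℝ (u k)) fun v => by
    obtain ⟨C, hC⟩ := (h.inner v).norm.bddAbove_range
    refine ⟨C, fun k => ?_⟩
    have := hC (Set.mem_range_self k)
    rwa [real_inner_comm] at this
  exact ⟨C, fun k => by simpa using hC k⟩

/-- Pairing of a weakly convergent with a strongly convergent sequence. -/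
lemma WeaklyTendsto.inner_tendsto [CompleteSpace U] (h : WeaklyTendsto u a) {g : ℕ → U} {b : U}
    (hg : Tendsto g atTop (𝓝 b)) : Tendsto (fun k => ⟪g k, u k⟫) atTop (𝓝 ⟪b, a⟫) := by
  obtain ⟨M, hM⟩ := h.norm_le
  have h1 : Tendsto (fun k => ⟪g k - b, u k⟫) atTop (𝓝 0) := by
    refine squeeze_zero_norm (a := fun k => ‖g k - b‖ * M) (fun k => ?_) ?_
    · exact (norm_inner_le_norm _ _).trans (by gcongr; exact hM k)
    · have := (tendsto_iff_norm_sub_tendsto_zero.1 hg).mul_const M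
      rwa [zero_mul] at this
  have h2 := h1.add (h.inner b)
  rw [zero_add] at h2
  refine h2.congr fun k => ?_
  rw [inner_sub_left]
  ring

lemma WeaklyTendsto.add_tendsto_zero (h : WeaklyTendsto u a) {s : ℕ → U}
    (hs : Tendsto s atTop (𝓝 0)) : WeaklyTendsto (fun k => u k + s k) a := by
  have h1 : Tendsto (fun k => toWeakSpace ℝ U (s k)) atTop (𝓝 (toWeakSpace ℝ U 0)) :=
    ((toWeakSpaceCLM ℝ U).continuous.tendsto 0).comp hs
  have h2 := Filter.Tendsto.add (show Tendsto (fun k => toWeakSpace ℝ U (u k)) atTop _ from h) h1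
  unfold WeaklyTendsto
  simpa using h2

lemma weaklyTendsto_of_tendsto (h : Tendsto u atTop (𝓝 a)) : WeaklyTendsto u a :=
  ((toWeakSpaceCLM ℝ U).continuous.tendsto a).comp h

end Weak

/-! ### Limits of the smoothed pseudonorm -/

section Limit

variable {d : ℕ} {Ω : Set (Dom d)} {U : Type*} [NormedAddCommGroup U] [InnerProductSpace ℝ U]
  (e : U ≃L[ℝ] H01 Ω) {p : ℝ}

lemma WeaklyTendsto.toL2 [CompleteSpace U] (hΩ : MeasurableSet Ω) (hΩ_bdd : Bornology.IsBounded Ω)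
    {u : ℕ → U} {a : U} (h : WeaklyTendsto u a) :
    Tendsto (fun k => toL2 e (u k)) atTop (𝓝 (toL2 e a)) := by
  obtain ⟨M, hM⟩ := h.norm_le
  rw [tendsto_iff_norm_sub_tendsto_zero]
  simp_rw [← map_sub]
  refine tendsto_norm_fst hΩ hΩ_bdd (w := fun k => e (u k - a))
    (M := ‖(e : U →L[ℝ] H01 Ω)‖ * (M + ‖a‖)) (fun k => ?_) fun g => ?_
  · refine ((e : U →L[ℝ] H01 Ω).le_opNorm _).trans ?_
    gcongr
    exact (norm_sub_le _ _).trans (by gcongr; exact hM k)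
  · have h1 := (h.apply ((innerSL ℝ g).comp (SmoothedTR.toL2 e))).sub_const ⟪g, SmoothedTR.toL2 e a⟫
    have h2 : ((innerSL ℝ g).comp (SmoothedTR.toL2 e)) a = ⟪g, SmoothedTR.toL2 e a⟫ := rfl
    rw [h2, sub_self] at h1
    refine h1.congr fun k => ?_
    change ⟪g, SmoothedTR.toL2 e (u k)⟫ - _ = ⟪g, SmoothedTR.toL2 e (u k - a)⟫
    rw [map_sub, inner_sub_right]

lemma exists_subseq_ae_tendsto {u : ℕ → U} {a : U}
    (h : Tendsto (fun k => toL2 e (u k)) atTop (𝓝 (toL2 e a))) :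
    ∃ ns : ℕ → ℕ, StrictMono ns ∧
      ∀ᵐ x ∂volume.restrict Ω, Tendsto (fun k => (e (u (ns k))).fn x) atTop (𝓝 ((e a).fn x)) :=
  (tendstoInMeasure_of_tendsto_Lp h).exists_seq_tendsto_ae

lemma integrable_abs_rpow (hΩ_bdd : Bornology.IsBounded Ω) (hp : 0 < p) (hp1 : p < 1) (u : U) :
    IntegrableOn (fun x => |(e u).fn x| ^ p) Ω := by
  have : IsFiniteMeasure (volume.restrict Ω) := ⟨by simpa using hΩ_bdd.measure_lt_top⟩
  refine Integrable.mono' ((integrable_const 1).add (integrable_fn_sq e u)) ?_ ?_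
  · exact ((aestronglyMeasurable_fn e u).aemeasurable.abs.pow_const p).aestronglyMeasurable
  · refine Eventually.of_forall fun x => ?_
    rw [Real.norm_of_nonneg (by positivity)]
    simpa using abs_rpow_le_add_sq hp hp1 one_pos ((e u).fn x)

lemma abs_lpPseudo_sub_le (hΩ_bdd : Bornology.IsBounded Ω) (hp : 0 < p) (hp1 : p < 1)
    {l : ℝ} (hl : 0 < l) (u v : U) :
    |lpPseudo e p u - lpPseudo e p v| ≤
      volume.real Ω * l ^ p + l ^ (p - 2) * ‖toL2 e u - toL2 e v‖ ^ 2 := by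
  have : IsFiniteMeasure (volume.restrict Ω) := ⟨by simpa using hΩ_bdd.measure_lt_top⟩
  rw [lpPseudo, lpPseudo, ← integral_sub (integrable_abs_rpow e hΩ_bdd hp hp1 u)
    (integrable_abs_rpow e hΩ_bdd hp hp1 v), ← map_sub, norm_toL2_sq]
  have hi := (integrable_fn_sq e (u - v)).const_mul (l ^ (p - 2))
  calc |∫ x in Ω, (|(e u).fn x| ^ p - |(e v).fn x| ^ p)|
      ≤ ∫ x in Ω, |(|(e u).fn x| ^ p - |(e v).fn x| ^ p)| := abs_integral_le_integral_abs
    _ ≤ ∫ x in Ω, (l ^ p + l ^ (p - 2) * (e (u - v)).fn x ^ 2) := by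
        refine integral_mono_ae ?_ ((integrable_const _).add hi) ?_
        · exact ((integrable_abs_rpow e hΩ_bdd hp hp1 u).sub
            (integrable_abs_rpow e hΩ_bdd hp hp1 v)).abs
        · filter_upwards [fn_sub e u v] with x hx
          rw [hx]
          exact (abs_rpow_sub_le hp hp1 _ _).trans (abs_rpow_le_add_sq hp hp1 hl _)
    _ = _ := by
        rw [integral_add (integrable_const _) hi, integral_const_mul]
        simp

lemma tendsto_lpPseudo (hΩ_bdd : Bornology.IsBounded Ω) (hp : 0 < p) (hp1 : p < 1)
    {u : ℕ → U} {a : U} (h : Tendsto (fun k => toL2 e (u k)) atTop (𝓝 (toL2 e a))) :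
    Tendsto (fun k => lpPseudo e p (u k)) atTop (𝓝 (lpPseudo e p a)) := by
  rw [Metric.tendsto_nhds]
  intro c hc
  -- Fix `l` first; the possibly huge factor `l ^ (p - 2)` is then a constant multiplying a null
  -- sequence.
  obtain ⟨l, hlc, hl⟩ : ∃ l : ℝ, volume.real Ω * l ^ p < c ∧ 0 < l := by
    have h1 : Tendsto (fun l : ℝ => volume.real Ω * l ^ p) (𝓝[>] 0) (𝓝 0) := by
      have h2 := ((Real.continuousAt_rpow_const 0 p (Or.inr hp.le)).tendsto.const_mul
        (volume.real Ω)).mono_left (nhdsWithin_le_nhds (s := Set.Ioi 0))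
      rwa [Real.zero_rpow hp.ne', mul_zero] at h2
    exact ((h1.eventually_lt_const hc).and self_mem_nhdsWithin).exists
  have h3 : Tendsto (fun k => volume.real Ω * l ^ p +
      l ^ (p - 2) * ‖toL2 e (u k) - toL2 e a‖ ^ 2) atTop (𝓝 (volume.real Ω * l ^ p)) := by
    simpa using (((tendsto_iff_norm_sub_tendsto_zero.1 h).pow 2).const_mul
      (l ^ (p - 2))).const_add (volume.real Ω * l ^ p)
  filter_upwards [h3.eventually_lt_const hlc] with k hk
  exact (abs_lpPseudo_sub_le e hΩ_bdd hp hp1 hl _ _).trans_lt hk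

lemma integrable_weight_sq {ε : ℝ} (hp : 0 < p) (hp1 : p < 1) (hε : 0 < ε) (w v : U) :
    IntegrableOn (fun x => deriv (psi p ε) ((e w).fn x ^ 2) * (e v).fn x ^ 2) Ω :=
  integrable_weight_mul e hp hp1 hε w (integrable_fn_sq e v)

/-- `∫ ψ_ε'(w²) a² ≤ (p/2) ∫ |w|^p + 2 ∫ ψ_ε'(w²) a (a - w)`. -/
lemma integral_weight_sq_le (hΩ_bdd : Bornology.IsBounded Ω) {ε : ℝ} (hp : 0 < p) (hp1 : p < 1)
    (hε : 0 < ε) (w a : U) :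
    ∫ x in Ω, deriv (psi p ε) ((e w).fn x ^ 2) * (e a).fn x ^ 2 ≤
      p / 2 * lpPseudo e p w + 2 * ∫ x in Ω, deriv (psi p ε) ((e w).fn x ^ 2) *
        ((e a).fn x * (e (a - w)).fn x) := by
  have hi1 : IntegrableOn (fun x => p / 2 * |(e w).fn x| ^ p) Ω :=
    (integrable_abs_rpow e hΩ_bdd hp hp1 w).const_mul _
  have hi2 : IntegrableOn (fun x => 2 * (deriv (psi p ε) ((e w).fn x ^ 2) *
      ((e a).fn x * (e (a - w)).fn x))) Ω :=
    (integrable_weight_mul e hp hp1 hε w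
      ((memLp_fn e a).integrable_mul (memLp_fn e (a - w)))).const_mul _
  rw [lpPseudo, ← integral_const_mul, ← integral_const_mul, ← integral_add hi1 hi2]
  refine integral_mono_ae (integrable_weight_sq e hp hp1 hε w a) (hi1.add hi2) ?_
  filter_upwards [fn_sub e a w] with x hx
  have h1 := deriv_psi_mul_sq_le hp hp1 hε ((e w).fn x)
  have h2 := deriv_psi_nonneg hp hε ((e w).fn x ^ 2)
  simp only [hx, Pi.sub_apply]
  -- This is `a² = w² + 2a(a - w) - (a - w)²` with the last square dropped.
  nlinarith [mul_nonneg h2 (sq_nonneg ((e a).fn x - (e w).fn x))]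

/-- If `u_k` converges weakly, `a_k - u_k → 0` in `L²` and `∫ ψ_{ε_k}'(u_k²) a_k (a_k - u_k) → 0`,
then `∫ ψ_{ε_k}'(u_k²) a_k² → (p/2) ∫ |ū|^p`. -/
lemma tendsto_integral_weight_sq (hΩ_bdd : Bornology.IsBounded Ω) (hp : 0 < p) (hp1 : p < 1)
    {ε : ℕ → ℝ} (hε : ∀ k, 0 < ε k) (hε0 : Tendsto ε atTop (𝓝 0)) {u a : ℕ → U} {ubar : U}
    (hu : Tendsto (fun k => toL2 e (u k)) atTop (𝓝 (toL2 e ubar)))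
    (ha : Tendsto (fun k => toL2 e (a k)) atTop (𝓝 (toL2 e ubar)))
    (h0 : Tendsto (fun k => ∫ x in Ω, deriv (psi p (ε k)) ((e (u k)).fn x ^ 2) *
      ((e (a k)).fn x * (e (a k - u k)).fn x)) atTop (𝓝 0)) :
    Tendsto (fun k => ∫ x in Ω, deriv (psi p (ε k)) ((e (u k)).fn x ^ 2) * (e (a k)).fn x ^ 2)
      atTop (𝓝 (p / 2 * lpPseudo e p ubar)) := by
  have hupper : Tendsto (fun k => p / 2 * lpPseudo e p (u k) +
      2 * ∫ x in Ω, deriv (psi p (ε k)) ((e (u k)).fn x ^ 2) *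
        ((e (a k)).fn x * (e (a k - u k)).fn x)) atTop (𝓝 (p / 2 * lpPseudo e p ubar)) := by
    simpa using ((tendsto_lpPseudo e hΩ_bdd hp hp1 hu).const_mul (p / 2)).add (h0.const_mul 2)
  refine tendsto_of_subseq_tendsto fun ns hns => ?_
  obtain ⟨ms, hms, hua⟩ := exists_subseq_ae_tendsto e (hu.comp hns)
  obtain ⟨ls, hls, haa⟩ := exists_subseq_ae_tendsto e
    (ha.comp (hns.comp hms.tendsto_atTop))
  let q : ℕ → ℕ := fun k => ns (ms (ls k))
  have hq : Tendsto q atTop atTop := hns.comp (hms.tendsto_atTop.comp hls.tendsto_atTop)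
  refine ⟨fun k => ms (ls k), ?_⟩
  have hG := (integrable_abs_rpow e hΩ_bdd hp hp1 ubar).const_mul (p / 2)
  -- The weights have no bound uniform in `k`. Truncating at the expected limit density provides an
  -- integrable majorant and still bounds the integrand from below.
  let F : ℕ → Dom d → ℝ := fun k x =>
    min (deriv (psi p (ε (q k))) ((e (u (q k))).fn x ^ 2) * (e (a (q k))).fn x ^ 2)
      (p / 2 * |(e ubar).fn x| ^ p)
  have hFm : ∀ k, AEStronglyMeasurable (F k) (volume.restrict Ω) := fun k =>
    (integrable_weight_sq e hp hp1 (hε (q k)) (u (q k)) (a (q k))).1.inf hG.1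
  have hFb : ∀ k x, ‖F k x‖ ≤ p / 2 * |(e ubar).fn x| ^ p := fun k x => by
    rw [Real.norm_of_nonneg]
    · exact min_le_right _ _
    · exact le_min (mul_nonneg (deriv_psi_nonneg hp (hε _) _) (sq_nonneg _)) (by positivity)
  have hlower : Tendsto (fun k => ∫ x in Ω, F k x) atTop (𝓝 (p / 2 * lpPseudo e p ubar)) := by
    rw [lpPseudo, ← integral_const_mul]
    refine tendsto_integral_of_dominated_convergence _ hFm hG
      (fun k => Eventually.of_forall (hFb k)) ?_
    filter_upwards [hua, haa] with x h1 h2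
    exact tendsto_min_deriv_psi_mul_sq hp (fun k => hε (q k)) (hε0.comp hq) h2
      (h1.comp hls.tendsto_atTop)
  refine tendsto_of_tendsto_of_tendsto_of_le_of_le hlower (hupper.comp hq) (fun k => ?_)
    fun k => integral_weight_sq_le e hΩ_bdd hp hp1 (hε (q k)) _ _
  refine integral_mono_ae (hG.mono' (hFm k) (Eventually.of_forall (hFb k)))
    (integrable_weight_sq e hp hp1 (hε (q k)) _ _) (Eventually.of_forall fun x => min_le_left _ _)

end Limit

/-! ### Smooth functions -/

section Smooth

variable {U : Type*} [NormedAddCommGroup U] [InnerProductSpace ℝ U] [CompleteSpace U]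
  {L : ℝ≥0} {f : U → ℝ}

lemma IsLSmooth.norm_gradient_le (hf : IsLSmooth L f) (u : U) :
    ‖∇ f u‖ ≤ ‖∇ f 0‖ + L * ‖u‖ := by
  have h1 := hf.2.dist_le_mul u 0
  rw [dist_eq_norm, dist_zero_right] at h1
  have h2 := norm_sub_norm_le (∇ f u) (∇ f 0)
  linarith

lemma IsLSmooth.abs_sub_sub_le (hf : IsLSmooth L f) (u s : U) :
    |f (u + s) - f u - ⟪∇ f u, s⟫| ≤ L * ‖s‖ ^ 2 := by
  have h := Convex.norm_image_sub_le_of_norm_fderiv_le' (𝕜 := ℝ) (f := f) (C := L * ‖s‖)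
    (s := Metric.closedBall u ‖s‖) (x := u) (y := u + s) (φ := fderiv ℝ f u)
    (fun x _ => hf.1 x) (fun x hx => ?_) (convex_closedBall _ _) (by simp) (by simp)
  · rw [add_sub_cancel_left, ← inner_gradient_left, Real.norm_eq_abs] at h
    rwa [pow_two, ← mul_assoc]
  · have h1 : fderiv ℝ f x - fderiv ℝ f u =
        InnerProductSpace.toDual ℝ U (∇ f x - ∇ f u) := by
      simp [gradient]
    rw [h1, LinearIsometryEquiv.norm_map, ← dist_eq_norm]
    exact (hf.2.dist_le_mul x u).trans (by gcongr; exact hx)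

lemma IsLSmooth.abs_curvature_le (hf : IsLSmooth L f) (u : U) {s : U} (hs : 0 < ‖s‖) :
    |curvature f u s| ≤ 2 * L := by
  rw [curvature, abs_mul, abs_of_nonneg (by positivity), div_mul_eq_mul_div,
    div_le_iff₀ (by positivity)]
  linarith [hf.abs_sub_sub_le u s]

end Smooth

lemma tendsto_prox_sub_of_residual {U : Type*} [NormedAddCommGroup U]
    [InnerProductSpace ℝ U] {r : ℝ} (hr : 0 < r) {Φ : ℕ → U → ℝ} {u g : ℕ → U}
    (h : Tendsto (fun k => proxResidual r (Φ k) (g k) (u k)) atTop (𝓝 0)) :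
    Tendsto (fun k => prox r (Φ k) (u k - r • g k) - u k) atTop (𝓝 0) := by
  rw [tendsto_zero_iff_norm_tendsto_zero]
  have h1 := h.const_mul r
  rw [mul_zero] at h1
  refine h1.congr fun k => ?_
  rw [proxResidual, ← mul_assoc, mul_one_div_cancel hr.ne', one_mul]

/-! ### Stationarity of limits -/

section Stationarity

variable {d : ℕ} {Ω : Set (Dom d)} {U : Type*} [NormedAddCommGroup U] [InnerProductSpace ℝ U]
  [CompleteSpace U] (e : U ≃L[ℝ] H01 Ω) {p α β r : ℝ}

/-- Test the variational equation with `P k - u k`. All other terms pair a bounded sequence with a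
null sequence, so the `g k` need only be bounded. -/
lemma tendsto_weight_prox_sq (hΩ : MeasurableSet Ω) (hΩ_bdd : Bornology.IsBounded Ω)
    (hp : 0 < p) (hp1 : p < 1) (hα : 0 < α) (hβ : 0 < β) (hr : 0 < r) {ε : ℕ → ℝ}
    (hε : ∀ k, 0 < ε k) (hε0 : Tendsto ε atTop (𝓝 0)) {u g P : ℕ → U} {ubar : U} {G : ℝ}
    (hP : ∀ k, P k = prox r (phiMaj e p α β (ε k) (u k)) (u k - r • g k))
    (hu : WeaklyTendsto u ubar) (hPu : Tendsto (fun k => P k - u k) atTop (𝓝 0))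
    (hG : ∀ k, ‖g k‖ ≤ G) :
    Tendsto (fun k => 2 * ∫ x in Ω,
      deriv (psi p (ε k)) ((e (u k)).fn x ^ 2) * (e (P k)).fn x ^ 2) atTop
      (𝓝 (p * lpPseudo e p ubar)) := by
  have hPw : WeaklyTendsto P ubar := by
    simpa using hu.add_tendsto_zero hPu
  obtain ⟨M, hM⟩ := hPw.norm_le
  have hbdd : ∀ {y : ℕ → U} {C : ℝ}, (∀ k, ‖y k‖ ≤ C) →
      Tendsto (fun k => ⟪y k, P k - u k⟫) atTop (𝓝 0) := by
    intro y C hC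
    refine squeeze_zero_norm (a := fun k => C * ‖P k - u k‖) (fun k => ?_) ?_
    · exact (norm_inner_le_norm _ _).trans (by gcongr; exact hC k)
    · simpa using hPu.norm.const_mul C
  have h1 : Tendsto (fun k => ⟪P k - u k, P k - u k⟫) atTop (𝓝 0) := by
    simpa using Filter.Tendsto.inner (𝕜 := ℝ) hPu hPu
  have h2 := (((h1.const_mul (1 / r)).add (hbdd hG)).add ((hbdd hM).const_mul α)).const_mul
    (-(2 * β)⁻¹)
  simp only [mul_zero, add_zero] at h2
  have h3 := tendsto_integral_weight_sq e hΩ_bdd hp hp1 hε hε0 (hu.toL2 e hΩ hΩ_bdd)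
    (hPw.toL2 e hΩ hΩ_bdd) (h2.congr fun k => ?_)
  · have h4 := h3.const_mul 2
    rwa [← mul_assoc, mul_div_cancel₀ p two_ne_zero] at h4
  · have h5 := prox_phiMaj e hΩ_bdd hp hp1 (hε k) hα hβ hr (u k) (g k) (P k - u k)
    rw [← hP k] at h5
    generalize (∫ x in Ω, deriv (psi p (ε k)) ((e (u k)).fn x ^ 2) *
      ((e (P k)).fn x * (e (P k - u k)).fn x)) = I at h5 ⊢
    field_simp
    field_simp at h5
    linarith

/-- Test with `P k` itself. Strong convergence of `g` is needed here, since `⟪g k, P k⟫` pairs it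
with a merely weakly convergent sequence. -/
lemma tendsto_norm_prox_sq (hΩ : MeasurableSet Ω) (hΩ_bdd : Bornology.IsBounded Ω)
    (hp : 0 < p) (hp1 : p < 1) (hα : 0 < α) (hβ : 0 < β) (hr : 0 < r) {ε : ℕ → ℝ}
    (hε : ∀ k, 0 < ε k) (hε0 : Tendsto ε atTop (𝓝 0)) {u g P : ℕ → U} {ubar gbar : U}
    (hP : ∀ k, P k = prox r (phiMaj e p α β (ε k) (u k)) (u k - r • g k))
    (hu : WeaklyTendsto u ubar) (hPu : Tendsto (fun k => P k - u k) atTop (𝓝 0))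
    (hg : Tendsto g atTop (𝓝 gbar)) :
    Tendsto (fun k => α * ‖P k‖ ^ 2) atTop
      (𝓝 (-⟪gbar, ubar⟫ - β * (p * lpPseudo e p ubar))) := by
  have hPw : WeaklyTendsto P ubar := by
    simpa using hu.add_tendsto_zero hPu
  obtain ⟨G, hG⟩ := hg.norm.bddAbove_range
  have h1 := tendsto_weight_prox_sq e hΩ hΩ_bdd hp hp1 hα hβ hr hε hε0 hP hu hPu
    (G := G) fun k => hG (Set.mem_range_self k)
  have h2 := (((hPw.inner_tendsto hPu).const_mul (1 / r)).add (hPw.inner_tendsto hg)).neg.sub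
    (h1.const_mul β)
  rw [inner_zero_left, mul_zero, zero_add] at h2
  refine h2.congr fun k => ?_
  have h5 := prox_phiMaj e hΩ_bdd hp hp1 (hε k) hα hβ hr (u k) (g k) (P k)
  rw [← hP k, real_inner_self_eq_norm_sq] at h5
  simp_rw [← pow_two] at h5
  linarith

/-- The multiplier `λ̄ = -(∇f(ū) + α ū) / β`. -/
lemma exists_multiplier (hβ : 0 < β) (f : U → ℝ) (α : ℝ) (ubar : U) :
    ∃ lam : StrongDual ℝ U, (∀ v : U, α * ⟪ubar, v⟫ + β * lam v = -(fderiv ℝ f ubar v)) ∧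
      β * lam ubar = -⟪∇ f ubar, ubar⟫ - α * ‖ubar‖ ^ 2 := by
  have h : ∀ v, (β⁻¹ • innerSL ℝ (-(∇ f ubar) - α • ubar)) v =
      β⁻¹ * (-⟪∇ f ubar, v⟫ - α * ⟪ubar, v⟫) := fun v => by
    simp
  refine ⟨β⁻¹ • innerSL ℝ (-(∇ f ubar) - α • ubar), fun v => ?_, ?_⟩
  · rw [h, mul_inv_cancel_left₀ hβ.ne', ← inner_gradient_left]
    ring
  · rw [h, mul_inv_cancel_left₀ hβ.ne', real_inner_self_eq_norm_sq]

lemma exists_multiplier_of_weaklyTendsto (hΩ : MeasurableSet Ω)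
    (hΩ_bdd : Bornology.IsBounded Ω)
    (hp : 0 < p) (hp1 : p < 1) (hα : 0 < α) (hβ : 0 < β) (hr : 0 < r) {ε : ℕ → ℝ}
    (hε : ∀ k, 0 < ε k) (hε0 : Tendsto ε atTop (𝓝 0)) {f : U → ℝ} {u g P : ℕ → U} {ubar : U}
    (hP : ∀ k, P k = prox r (phiMaj e p α β (ε k) (u k)) (u k - r • g k))
    (hu : WeaklyTendsto u ubar) (hPu : Tendsto (fun k => P k - u k) atTop (𝓝 0))
    (hg : Tendsto g atTop (𝓝 (∇ f ubar))) :
    ∃ lam : StrongDual ℝ U, (∀ v : U, α * ⟪ubar, v⟫ + β * lam v = -(fderiv ℝ f ubar v)) ∧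
      p * lpPseudo e p ubar ≤ lam ubar := by
  obtain ⟨lam, h1, h2⟩ := exists_multiplier hβ f α ubar
  refine ⟨lam, h1, le_of_mul_le_mul_left ?_ hβ⟩
  have h3 := tendsto_norm_prox_sq e hΩ hΩ_bdd hp hp1 hα hβ hr hε hε0 hP hu hPu hg
  have hPw : WeaklyTendsto P ubar := by
    simpa using hu.add_tendsto_zero hPu
  have h4 := (((hPw.inner ubar).const_mul 2).sub_const (‖ubar‖ ^ 2)).const_mul α
  rw [real_inner_self_eq_norm_sq] at h4
  -- Weak lower semicontinuity of the norm, from `2⟪ū, P⟫ - ‖ū‖² ≤ ‖P‖²`.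
  have h5 := le_of_tendsto_of_tendsto' h4 h3 fun k => by
    have := norm_sub_sq_real ubar (P k)
    gcongr
    nlinarith [sq_nonneg ‖ubar - P k‖]
  linarith

lemma exists_multiplier_of_tendsto (hΩ : MeasurableSet Ω) (hΩ_bdd : Bornology.IsBounded Ω)
    (hp : 0 < p) (hp1 : p < 1) (hα : 0 < α) (hβ : 0 < β) (hr : 0 < r) {ε : ℕ → ℝ}
    (hε : ∀ k, 0 < ε k) (hε0 : Tendsto ε atTop (𝓝 0)) {f : U → ℝ} {u g P : ℕ → U} {ubar : U}
    (hP : ∀ k, P k = prox r (phiMaj e p α β (ε k) (u k)) (u k - r • g k))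
    (hu : Tendsto u atTop (𝓝 ubar)) (hPu : Tendsto (fun k => P k - u k) atTop (𝓝 0))
    (hg : Tendsto g atTop (𝓝 (∇ f ubar))) :
    ∃ lam : StrongDual ℝ U, (∀ v : U, α * ⟪ubar, v⟫ + β * lam v = -(fderiv ℝ f ubar v)) ∧
      lam ubar = p * lpPseudo e p ubar := by
  obtain ⟨lam, h1, h2⟩ := exists_multiplier hβ f α ubar
  refine ⟨lam, h1, mul_left_cancel₀ hβ.ne' ?_⟩
  have h3 := tendsto_norm_prox_sq e hΩ hΩ_bdd hp hp1 hα hβ hr hε hε0 hP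
    (weaklyTendsto_of_tendsto hu) hPu hg
  have hPs : Tendsto P atTop (𝓝 ubar) := by simpa using hPu.add hu
  have h5 := tendsto_nhds_unique h3 ((hPs.norm.pow 2).const_mul α)
  linarith

end Stationarity

/-! ### The trust-region algorithm -/

section TrustRegion

namespace Data

variable {d : ℕ} {Ω : Set (Dom d)} {U : Type*} [NormedAddCommGroup U] [InnerProductSpace ℝ U]
  [CompleteSpace U] {D : Data U} {e : U ≃L[ℝ] H01 Ω} {p α β : ℝ} {f : U → ℝ}

lemma omega_nonneg (D : Data U) (k : ℕ) : 0 ≤ D.omega k := by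
  refine Real.sSup_nonneg ?_
  rintro _ ⟨s, _, _, rfl⟩
  exact abs_nonneg _

lemma one_add_omega_le_b (D : Data U) {k : ℕ} (hk : 1 ≤ k) : 1 + D.omega k ≤ D.b k := by
  rw [b]
  gcongr
  exact le_csSup ((Set.finite_Icc 1 k).image _).bddAbove ⟨k, ⟨hk, le_rfl⟩, rfl⟩

lemma one_le_b (D : Data U) (k : ℕ) : 1 ≤ D.b k := by
  rw [b]
  have : 0 ≤ sSup (D.omega '' Set.Icc 1 k) := by
    refine Real.sSup_nonneg ?_
    rintro _ ⟨i, _, rfl⟩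
    exact D.omega_nonneg i
  linarith

lemma abs_model_sub_le {k : ℕ} {L : ℝ≥0} (hL : IsLSmooth L (D.model k)) {s : U}
    (hs : ‖s‖ ≤ D.κrad * D.Δ k) :
    |D.model k (D.u k + s) - D.model k (D.u k) - ⟪∇ (D.model k) (D.u k), s⟫| ≤
      D.omega k * ‖s‖ ^ 2 := by
  rcases (norm_nonneg s).eq_or_lt with h0 | h0
  · simp [norm_eq_zero.1 h0.symm]
  have h1 : |curvature (D.model k) (D.u k) s| ≤ D.omega k := by
    -- The Lipschitz gradient bounds the curvatures, so `sSup` is a true supremum and not the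
    -- default value `0`.
    refine le_csSup ⟨2 * L, ?_⟩ ⟨s, h0, hs, rfl⟩
    rintro _ ⟨t, ht, _, rfl⟩
    exact hL.abs_curvature_le _ ht
  rw [curvature, abs_mul, abs_of_nonneg (by positivity), div_mul_eq_mul_div,
    div_le_iff₀ (by positivity)] at h1
  have h2 := abs_nonneg
    (D.model k (D.u k + s) - D.model k (D.u k) - ⟪∇ (D.model k) (D.u k), s⟫)
  linarith

lemma IsRun.h_nonneg (hD : D.IsRun e p α β) (k : ℕ) : 0 ≤ D.h e p α β k := by
  have := hD.r₀_pos
  rw [h, proxResidual]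
  positivity

lemma IsRun.Δ_pos (hD : D.IsRun e p α β) (k : ℕ) : 0 < D.Δ k := by
  induction k with
  | zero => exact hD.Δ_zero_pos
  | succ k ih =>
    have h1 := hD.γ₁_pos
    have h2 : 0 < D.γ₂ := h1.trans_le hD.γ₁_le_γ₂
    by_cases hs : D.rho e p α β k < D.η₁
    · exact (mul_pos h1 ih).trans_le (hD.radius_unsuccessful k hs).1
    · by_cases hv : D.rho e p α β k < D.η₂
      · exact (mul_pos h2 ih).trans_le (hD.radius_successful k (not_lt.1 hs) hv).1
      · exact ih.trans_le (hD.radius_very_successful k (not_lt.1 hv)).1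

/-- `|ared_k - pred_k| ≤ C b_k Δ_k²`. -/
lemma IsRun.abs_ared_sub_pred_le (hD : D.IsRun e p α β) {L : ℝ≥0} (hf : IsLSmooth L f)
    {κ : ℝ} (hκ : 0 ≤ κ) {k : ℕ} (hk : 1 ≤ k) {Lk : ℝ≥0} (hm : IsLSmooth Lk (D.model k))
    (hg : ‖∇ (D.model k) (D.u k) - ∇ f (D.u k)‖ ≤ κ * min (D.h e p α β k) (D.Δ k)) :
    |D.ared e p α β f k - D.pred e p α β k| ≤
      (κ * D.κrad + (1 + L) * D.κrad ^ 2) * (D.b k * D.Δ k ^ 2) := by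
  obtain ⟨s, hs⟩ : ∃ s, D.trial k = D.u k + s := ⟨D.trial k - D.u k, by abel⟩
  have hsn : ‖s‖ ≤ D.κrad * D.Δ k := by simpa [hs] using hD.trial_mem k
  have h1 := abs_model_sub_le hm hsn
  have h2 := hf.abs_sub_sub_le (D.u k) s
  have h3 : |⟪∇ (D.model k) (D.u k) - ∇ f (D.u k), s⟫| ≤ κ * D.Δ k * (D.κrad * D.Δ k) := by
    refine (abs_real_inner_le_norm _ _).trans ?_
    have : κ * min (D.h e p α β k) (D.Δ k) ≤ κ * D.Δ k := by
      gcongr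
      exact min_le_right _ _
    have hΔ := (hD.Δ_pos k).le
    exact mul_le_mul (hg.trans this) hsn (norm_nonneg _) (by positivity)
  -- The regularizer is the same in both reductions and cancels, whichever model was chosen.
  have heq : D.ared e p α β f k - D.pred e p α β k =
      (D.model k (D.u k + s) - D.model k (D.u k) - ⟪∇ (D.model k) (D.u k), s⟫) -
      (f (D.u k + s) - f (D.u k) - ⟪∇ f (D.u k), s⟫) +
      ⟪∇ (D.model k) (D.u k) - ∇ f (D.u k), s⟫ := by
    rw [ared, pred, mod, mod, hs, inner_sub_left]
    ring
  have hb := D.one_le_b k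
  have hob := D.one_add_omega_le_b hk
  have ho := D.omega_nonneg k
  have hs2 : ‖s‖ ^ 2 ≤ (D.κrad * D.Δ k) ^ 2 := by gcongr
  have hΔ := (hD.Δ_pos k).le
  have hr := hD.κrad_pos.le
  calc |D.ared e p α β f k - D.pred e p α β k|
      ≤ D.omega k * ‖s‖ ^ 2 + L * ‖s‖ ^ 2 + κ * D.Δ k * (D.κrad * D.Δ k) := by
        rw [heq]
        exact (abs_add_le _ _).trans
          (add_le_add ((abs_sub _ _).trans (add_le_add h1 h2)) h3)
    _ ≤ D.b k * (D.κrad * D.Δ k) ^ 2 + L * (D.b k * (D.κrad * D.Δ k) ^ 2) +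
        κ * D.κrad * (D.b k * D.Δ k ^ 2) := by
        have h4 : D.omega k * ‖s‖ ^ 2 ≤ D.b k * (D.κrad * D.Δ k) ^ 2 :=
          mul_le_mul (by linarith) hs2 (by positivity) (by linarith)
        have h5 : ‖s‖ ^ 2 ≤ D.b k * (D.κrad * D.Δ k) ^ 2 :=
          hs2.trans (le_mul_of_one_le_left (by positivity) hb)
        have h6 : D.Δ k ^ 2 ≤ D.b k * D.Δ k ^ 2 := le_mul_of_one_le_left (by positivity) hb
        have h7 : κ * D.Δ k * (D.κrad * D.Δ k) ≤ κ * D.κrad * (D.b k * D.Δ k ^ 2) := by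
          calc κ * D.Δ k * (D.κrad * D.Δ k) = κ * D.κrad * D.Δ k ^ 2 := by ring
            _ ≤ _ := by gcongr
        gcongr
    _ = _ := by ring

/-- The radii shrink geometrically once all iterations are unsuccessful. -/
lemma IsRun.Δ_add_le (hD : D.IsRun e p α β) {K : ℕ}
    (hK : ∀ k, K ≤ k → D.rho e p α β k < D.η₁) (n : ℕ) :
    D.Δ (n + K) ≤ D.γ₂ ^ n * D.Δ K := by
  have h2 : 0 < D.γ₂ := hD.γ₁_pos.trans_le hD.γ₁_le_γ₂
  induction n with
  | zero => simp
  | succ n ih =>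
    have h1 := (hD.radius_unsuccessful (n + K) (hK _ (by omega))).2
    rw [add_right_comm]
    calc _ ≤ D.γ₂ * D.Δ (n + K) := h1
      _ ≤ D.γ₂ * (D.γ₂ ^ n * D.Δ K) := by gcongr
      _ = _ := by ring

lemma IsRun.summable_Δ (hD : D.IsRun e p α β) {K : ℕ}
    (hK : ∀ k, K ≤ k → D.rho e p α β k < D.η₁) : Summable D.Δ := by
  have h2 : 0 < D.γ₂ := hD.γ₁_pos.trans_le hD.γ₁_le_γ₂
  rw [← summable_nat_add_iff K]
  exact Summable.of_nonneg_of_le (fun n => (hD.Δ_pos _).le) (hD.Δ_add_le hK)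
    ((summable_geometric_of_lt_one h2.le hD.γ₂_lt_one).mul_right _)

/-- Otherwise `1 / b_k ≤ Δ_k / δ` eventually, and the divergent series would be summable. -/
lemma CurvatureCondition.frequently_lt (hb : D.CurvatureCondition) (hΔ : Summable D.Δ) {δ : ℝ}
    (hδ : 0 < δ) : ∃ᶠ k in atTop, D.b k * D.Δ k < δ := by
  intro hev
  have hpos : ∀ k, 0 < D.b k := fun k => one_pos.trans_le (D.one_le_b k)
  have hsum : Summable fun k => 1 / D.b k := by
    refine (hΔ.mul_left δ⁻¹).of_norm_bounded_eventually_nat ?_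
    filter_upwards [hev] with k hk
    rw [Real.norm_of_nonneg (by have := hpos k; positivity), div_le_iff₀ (hpos k), mul_assoc,
      mul_comm (D.Δ k), ← div_eq_inv_mul, le_div_iff₀ hδ, one_mul]
    exact not_lt.1 hk
  obtain ⟨n, hn⟩ := (hb.eventually_gt_atTop (∑' k, 1 / D.b k)).exists
  exact absurd hn (not_lt.2 (hsum.sum_le_tsum _ fun k _ => by have := hpos k; positivity))

/-- If only finitely many iterations are successful, `h_k` becomes arbitrarily small. -/
lemma IsRun.frequently_h_lt (hD : D.IsRun e p α β) {L : ℝ≥0} (hf : IsLSmooth L f)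
    (hgrad : D.InexactGradient e p α β f) (hobj : D.InexactObjective e p α β f)
    (hb : D.CurvatureCondition) {K : ℕ} (hK : ∀ k, K ≤ k → D.rho e p α β k < D.η₁)
    {c : ℝ} (hc : 0 < c) : ∃ᶠ k in atTop, D.h e p α β k < c := by
  intro hev
  obtain ⟨hsm, κ, hκ, hg⟩ := hgrad
  obtain ⟨κobj, η, ζ, θ, hκo, hζ, hη, -, hθ, hθ0, hcred⟩ := hobj
  have hfcd := hD.κfcd_pos
  have hrad := hD.κrad_pos
  let C : ℝ := κ * D.κrad + (1 + L) * D.κrad ^ 2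
  have hC : 0 < C := by positivity
  have hη1 : 0 < (1 - D.η₁) / 2 := by linarith [hD.η₁_lt_η₂, hD.η₂_lt_one]
  -- The first bound makes `Δ_k` the minimum in the decrease condition; the second makes the model
  -- error at most `(1 - η₁)/2 · pred_k`.
  have hδ : 0 < min c ((1 - D.η₁) / 2 * (D.κfcd * c) / C) := lt_min hc (by positivity)
  -- As `ζ > 1`, one power of the minimum is spent on `pred_k` and the remaining `ζ - 1` give a
  -- vanishing factor.
  have hθlim : Tendsto (fun k => κobj * η ^ ζ * θ k ^ (ζ - 1)) atTop (𝓝 0) := by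
    have := (hθ0.rpow_const (p := ζ - 1) (Or.inr (by linarith))).const_mul (κobj * η ^ ζ)
    rwa [Real.zero_rpow (by linarith), mul_zero] at this
  obtain ⟨k, hkδ, hkh, hkθ, hkK, hk1⟩ := ((hb.frequently_lt (hD.summable_Δ hK) hδ).and_eventually
    (hev.and ((hθlim.eventually_lt_const hη1).and
      ((eventually_ge_atTop K).and (eventually_ge_atTop 1))))).exists
  have hkh : c ≤ D.h e p α β k := not_lt.1 hkh
  have hΔ := hD.Δ_pos k
  have hω := D.omega_nonneg k
  have hωb := D.one_add_omega_le_b hk1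
  have hpred : D.κfcd * c * D.Δ k ≤ D.pred e p α β k := by
    refine le_trans ?_ (hD.fcd k)
    have h1 : D.Δ k ≤ D.h e p α β k / (1 + D.omega k) := by
      rw [le_div_iff₀ (by positivity)]
      calc D.Δ k * (1 + D.omega k) ≤ D.Δ k * D.b k := by gcongr
        _ = D.b k * D.Δ k := mul_comm _ _
        _ ≤ c := hkδ.le.trans (min_le_left _ _)
        _ ≤ _ := hkh
    rw [min_eq_right h1]
    gcongr
  have hpred0 : 0 < D.pred e p α β k := lt_of_lt_of_le (by positivity) hpred
  have h1 : |D.ared e p α β f k - D.pred e p α β k| ≤ (1 - D.η₁) / 2 * D.pred e p α β k := by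
    obtain ⟨Lk, hLk⟩ := hsm k
    calc _ ≤ C * (D.b k * D.Δ k ^ 2) := hD.abs_ared_sub_pred_le hf hκ hk1 hLk (hg k)
      _ = C * (D.b k * D.Δ k) * D.Δ k := by ring
      _ ≤ C * ((1 - D.η₁) / 2 * (D.κfcd * c) / C) * D.Δ k := by
        gcongr
        exact hkδ.le.trans (min_le_right _ _)
      _ = (1 - D.η₁) / 2 * (D.κfcd * c * D.Δ k) := by field_simp
      _ ≤ _ := by gcongr
  have h2 : |D.ared e p α β f k - D.cred k| ≤ (1 - D.η₁) / 2 * D.pred e p α β k := by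
    have hm0 : 0 ≤ min (D.pred e p α β k) (θ k) := le_min hpred0.le (hθ k)
    have hpow : min (D.pred e p α β k) (θ k) ^ ζ ≤ θ k ^ (ζ - 1) * D.pred e p α β k := by
      calc min (D.pred e p α β k) (θ k) ^ ζ
          = min (D.pred e p α β k) (θ k) ^ (ζ - 1) * min (D.pred e p α β k) (θ k) := by
            rw [← Real.rpow_add_one' hm0 (by linarith), sub_add_cancel]
        _ ≤ θ k ^ (ζ - 1) * D.pred e p α β k := by
            refine mul_le_mul (Real.rpow_le_rpow hm0 (min_le_right _ _) (by linarith))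
              (min_le_left _ _) hm0 (Real.rpow_nonneg (hθ k) _)
    calc _ ≤ κobj * (η * min (D.pred e p α β k) (θ k)) ^ ζ := hcred k
      _ = κobj * η ^ ζ * min (D.pred e p α β k) (θ k) ^ ζ := by
        rw [Real.mul_rpow hη.le hm0, mul_assoc]
      _ ≤ κobj * η ^ ζ * (θ k ^ (ζ - 1) * D.pred e p α β k) := by gcongr
      _ = κobj * η ^ ζ * θ k ^ (ζ - 1) * D.pred e p α β k := by ring
      _ ≤ _ := by gcongr
  -- The two errors together cost at most `(1 - η₁) pred_k`.
  have h3 : D.η₁ ≤ D.rho e p α β k := by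
    rw [rho, le_div_iff₀ hpred0]
    have h4 := (abs_le.1 h1).1
    have h5 := (abs_le.1 h2).2
    linarith
  exact absurd (hK k hkK) (not_lt.2 h3)

end Data

end TrustRegion

end SmoothedTR

/-- Eventually constant iterates converge strongly, which gives equality. Only indices `σ n → ∞`
with `h → 0` are available; along them the gradient error, at most `κ h`, vanishes too. -/
lemma SmoothedTR.Data.IsRun.exists_multiplier_of_finite {d : ℕ} {Ω : Set (SmoothedTR.Dom d)}
    (hΩ : MeasurableSet Ω) (hΩ_bdd : Bornology.IsBounded Ω) {U : Type*} [NormedAddCommGroup U]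
    [InnerProductSpace ℝ U] [CompleteSpace U] {e : U ≃L[ℝ] SmoothedTR.H01 Ω} {p α β : ℝ}
    (hp : 0 < p) (hp1 : p < 1) (hα : 0 < α) (hβ : 0 < β) {f : U → ℝ} {L : ℝ≥0}
    (hf : SmoothedTR.IsLSmooth L f) {D : SmoothedTR.Data U} (hD : D.IsRun e p α β)
    (hgrad : D.InexactGradient e p α β f) (hobj : D.InexactObjective e p α β f)
    (hb : D.CurvatureCondition) (hfin : (D.successful e p α β).Finite) :
    ∃ ubar : U, (∀ᶠ k in atTop, D.u k = ubar) ∧ ∃ lam : StrongDual ℝ U,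
      (∀ v : U, α * ⟪ubar, v⟫ + β * lam v = -(fderiv ℝ f ubar v)) ∧
      lam ubar = p * SmoothedTR.lpPseudo e p ubar := by
  obtain ⟨K, hK⟩ : ∃ K, ∀ k, K ≤ k → D.rho e p α β k < D.η₁ := by
    obtain ⟨K, hK⟩ := hfin.bddAbove
    exact ⟨K + 1, fun k hk => not_le.1 fun h => absurd (hK h) (by omega)⟩
  have hconst : ∀ k, K ≤ k → D.u k = D.u K := fun k hk => by
    induction k, hk using Nat.le_induction with
    | base => rfl
    | succ k hk ih => rw [hD.reject k (hK k hk), ih]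
  refine ⟨D.u K, (eventually_ge_atTop K).mono hconst, ?_⟩
  have hex : ∀ n : ℕ, ∃ k, n ≤ k ∧ K ≤ k ∧ D.h e p α β k < 1 / ((n : ℝ) + 1) := fun n => by
    obtain ⟨k, h1, h2, h3⟩ := ((hD.frequently_h_lt hf hgrad hobj hb hK
      (c := 1 / ((n : ℝ) + 1)) (by positivity)).and_eventually
        ((eventually_ge_atTop n).and (eventually_ge_atTop K))).exists
    exact ⟨k, h2, h3, h1⟩
  choose σ hσn hσK hσh using hex
  have hσ : Tendsto σ atTop atTop := tendsto_atTop_mono hσn tendsto_id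
  have hh : Tendsto (fun n => D.h e p α β (σ n)) atTop (𝓝 0) :=
    squeeze_zero (fun n => hD.h_nonneg _) (fun n => (hσh n).le)
      tendsto_one_div_add_atTop_nhds_zero_nat
  obtain ⟨-, κ, hκ, hg⟩ := hgrad
  have hgt : Tendsto (fun n => ∇ (D.model (σ n)) (D.u (σ n))) atTop (𝓝 (∇ f (D.u K))) := by
    rw [tendsto_iff_norm_sub_tendsto_zero]
    refine squeeze_zero (fun _ => norm_nonneg _) (fun n => ?_) (by simpa using hh.const_mul κ)
    rw [← hconst _ (hσK n)]
    refine (hg (σ n)).trans ?_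
    gcongr
    exact min_le_left _ _
  exact SmoothedTR.exists_multiplier_of_tendsto e hΩ hΩ_bdd hp hp1 hα hβ hD.r₀_pos
    (fun n => hD.ε_pos (σ n)) (hD.ε_tendsto.comp hσ) (fun _ => rfl)
    (tendsto_const_nhds.congr fun n => (hconst _ (hσK n)).symm)
    (SmoothedTR.tendsto_prox_sub_of_residual hD.r₀_pos hh) hgt

theorem mainTheorem9
    {d : ℕ} (hd : 1 ≤ d) {Ω : Set (SmoothedTR.Dom d)}
    (hΩ_open : IsOpen Ω) (hΩ_conn : IsConnected Ω) (hΩ_bdd : Bornology.IsBounded Ω)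
    -- `U` is `H_0^1(Ω)` with some Hilbert inner product equivalent to the standard one
    {U : Type*} [NormedAddCommGroup U] [InnerProductSpace ℝ U] [CompleteSpace U]
    (e : U ≃L[ℝ] SmoothedTR.H01 Ω)
    {p α β : ℝ} (hp₀ : 0 < p) (hp₁ : p < 1) (hα : 0 < α) (hβ : 0 < β)
    {f : U → ℝ} {L : ℝ≥0} (hL : 0 < L) (hf : SmoothedTR.IsLSmooth L f)
    (hF : BddBelow (Set.range fun u => f u + SmoothedTR.phi e p α β u)) :
    -- auxiliary convergence result
    (∀ (r₀ : ℝ) (ε : ℕ → ℝ) (u P : ℕ → U) (ubar : U), 0 < r₀ →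
      (∀ k, 0 < ε k) → Antitone ε → Tendsto ε atTop (𝓝 0) →
      (∀ k, P k = SmoothedTR.prox r₀ (SmoothedTR.phiMaj e p α β (ε k) (u k))
        (u k - r₀ • ∇ f (u k))) →
      SmoothedTR.WeaklyTendsto u ubar →
      Tendsto (fun k => P k - u k) atTop (𝓝 0) →
      Tendsto (fun k => 2 * ∫ x in Ω,
          deriv (SmoothedTR.psi p (ε k)) ((e (u k)).fn x ^ 2) * (e (P k)).fn x ^ 2)
        atTop (𝓝 (p * SmoothedTR.lpPseudo e p ubar))) ∧
    -- finitely many successful iterations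
    (∀ D : SmoothedTR.Data U, D.IsRun e p α β →
      D.InexactGradient e p α β f → D.InexactObjective e p α β f → D.CurvatureCondition →
      (D.successful e p α β).Finite →
      ∃ ubar : U, (∀ᶠ k in atTop, D.u k = ubar) ∧
        ∃ lam : StrongDual ℝ U,
          (∀ v : U, α * ⟪ubar, v⟫ + β * lam v = -(fderiv ℝ f ubar v)) ∧
          lam ubar = p * SmoothedTR.lpPseudo e p ubar) ∧
    -- weak accumulation points
    (SmoothedTR.IsCompletelyContinuous (∇ f) →
      ∀ (r₀ : ℝ) (ε : ℕ → ℝ) (u : ℕ → U) (σ τ : ℕ → ℕ) (ubar : U), 0 < r₀ →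
      (∀ k, 0 < ε k) → Antitone ε → Tendsto ε atTop (𝓝 0) →
      StrictMono σ →
      Tendsto (fun k => SmoothedTR.proxResidual r₀
          (SmoothedTR.phiMaj e p α β (ε (σ k)) (u (σ k))) (∇ f (u (σ k))) (u (σ k)))
        atTop (𝓝 0) →
      StrictMono τ → SmoothedTR.WeaklyTendsto (fun k => u (σ (τ k))) ubar →
      ∃ lam : StrongDual ℝ U,
        (∀ v : U, α * ⟪ubar, v⟫ + β * lam v = -(fderiv ℝ f ubar v)) ∧
        p * SmoothedTR.lpPseudo e p ubar ≤ lam ubar) := by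
  have hΩ := hΩ_open.measurableSet
  refine ⟨?_, ?_, ?_⟩
  · intro r₀ ε u P ubar hr hε _ hε0 hP hu hPu
    -- Weak convergence bounds the iterates and the Lipschitz gradient then bounds `∇ f (u k)`, so
    -- complete continuity plays no role here.
    obtain ⟨M, hM⟩ := hu.norm_le
    exact SmoothedTR.tendsto_weight_prox_sq e hΩ hΩ_bdd hp₀ hp₁ hα hβ hr hε hε0 hP hu hPu
      (G := ‖∇ f 0‖ + L * M) fun k => (hf.norm_gradient_le (u k)).trans (by gcongr; exact hM k)
  · intro D hD hgrad hobj hb hfin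
    exact hD.exists_multiplier_of_finite hΩ hΩ_bdd hp₀ hp₁ hα hβ hf hgrad hobj hb hfin
  · intro hcc r₀ ε u σ τ ubar hr hε _ hε0 hσ hres hτ hu
    have h1 := hσ.tendsto_atTop.comp hτ.tendsto_atTop
    exact SmoothedTR.exists_multiplier_of_weaklyTendsto e hΩ hΩ_bdd hp₀ hp₁ hα hβ hr
      (fun k => hε (σ (τ k))) (hε0.comp h1) (fun _ => rfl) hu
      (SmoothedTR.tendsto_prox_sub_of_residual hr (hres.comp hτ.tendsto_atTop)) (hcc _ _ hu)

end
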